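/- Let $\Bbbk$ be an algebraically closed field of characteristic $0$. A rack is a set $X$ with an operation $\triangleright$ such that every map $y\mapsto x\triangleright y$ is bijective and $x\triangleright(y\triangleright z)=(x\triangleright y)\triangleright(x\triangleright z)$; it is braided if $x\triangleright x=x$ for all $x$ and, for all $x,y\in X$, $x\triangleright y=y$ or $x\triangleright(y\triangleright x)=y$. We say that $x$ commutes with $y$ if $x\triangleright y=y$. Let $X$ be a rack and let $q:X\times X\to\Bbbk^\times$ be a two-cocycle, that is, $q_{x\triangleright y,x\triangleright z}\,q_{x,z}=q_{x,y\triangleright z}\,q_{y,z}$ for all $x,y,z\in X$. Let $V$ be the vector space with basis $(v_x)_{x\in X}$ and braiding $c_q(v_x\otimes v_y)=q_{x,y}\,v_{x\triangleright y}\otimes v_x$, regarded as a Yetter–Drinfeld module over the enveloping group $G_X=\langle g_x\,(x\in X)\mid g_xg_y=g_{x\triangleright y}g_x\rangle$, where $v_x$ has degree $g_x$ and $g_x\cdot v_y=q_{x,y}v_{x\triangleright y}$. Let $c_i\in\operatorname{Aut}(V^{\otimes n})$ be $c_q$ applied to the tensor factors $i$ and $i+1$. Let $S_n=\sum_{s\in\mathbb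 S_n}c_{i_1}\cdots c_{i_r}$ be the braided symmetrizer on $V^{\otimes n}$, where $s=(i_1\ i_1{+}1)\cdots(i_r\ i_r{+}1)$ is a reduced expression of $s$. Let $\mathcal B(V)=\bigoplus_{n\ge0}V^{\otimes n}/\ker S_n$ be the Nichols algebra of $V$, with its multiplication $\mu$, its comultiplication $\Delta$ as a braided Hopf algebra (for which the elements of $V$ are primitive), its $\mathbb N_0$-grading and its $\Bbbk G_X$-coaction. We say that $\mathcal B(V)$ is slim in degree two if in $\mathcal B(V)$ \[\mu(\mathrm{id}-c_q)(v_x\otimes v_y)=0\ \text{ whenever } x\triangleright y=y\ne x,\qquad \mu(\mathrm{id}-c_q+c_q^2)(v_x\otimes v_y)=0\ \text{ whenever } x\triangleright y\neq y .\] For a subset $T\subseteq\mathcal B(V)$ write $\langle T\rangle$ for the unital subalgebra generated by $T$. A left coideal subalgebra of $\mathcal B(V)$ in the category of $\mathbb N_0$-graded $\Bbbk G_X$-comodules is a unital subalgebra $C$ with $\Delta(C)\subseteq\mathcal B(V)\otimes C$ that is an $\mathbb N_0$-graded subspace and a $\Bbbk G_X$-subcomodule; it is generated in degree one if $C=\langle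 C(1)\rangle$, where $C(1)$ is its component of degree one. **Theorem.** Assume that $X$ is braided and that $\mathcal B(V)$ is slim in degree two. Let $a,b,c\in X$ be pairwise distinct with $a\triangleright b\ne b$. Put $d=c\triangleright(b\triangleright a)$, $e=d\triangleright(c\triangleright b)$, $S=\{v_a,v_b,v_d,v_e\}$, \[Z=\mu\bigl(\mathrm{id}-c_1c_2+(c_1c_2)^2\bigr)(v_c\otimes v_b\otimes v_a)\in\mathcal B(V),\qquad C=\langle S\cup\{Z\}\rangle .\] 1. $C$ is a left coideal subalgebra of $\mathcal B(V)$ in the category of $\mathbb N_0$-graded $\Bbbk G_X$-comodules. 2. If $c$ commutes with none of $a$, $b$, $b\triangleright a$, and $a\triangleright b\ne c$ or $a\triangleright c\ne b\triangleright a$, then $Z\notin\langle S\rangle$, and $C$ is not generated in degree one. -/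

import Mathlib

namespace RackNichols

/-! ### Reduced words in the symmetric group -/

/-- The product in a monoid `M` obtained by replacing the letter `i` of `L` by `f i`. -/
def evalWord {M : Type*} [Monoid M] (f : ℕ → M) (L : List ℕ) : M := (L.map f).prod

/-- The transposition of `i` and `i + 1`. -/
def adjSwap (i : ℕ) : Equiv.Perm ℕ := Equiv.swap i (i + 1)

/-- `L` is a word in the transpositions of neighbours in `{0, …, n - 1}`, and its product is `s`. -/
def IsWordOf (n : ℕ) (s : Equiv.Perm (Fin n)) (L : List ℕ) : Prop :=
  (∀ i ∈ L, i + 1 < n) ∧ ∀ j : Fin n, ((s j : Fin n) : ℕ) = evalWord adjSwap L j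

/-- `L` is a reduced word for `s`, that is, a word for `s` of minimal length. -/
def IsReducedWordOf (n : ℕ) (s : Equiv.Perm (Fin n)) (L : List ℕ) : Prop :=
  IsWordOf n s L ∧ ∀ L', IsWordOf n s L' → L.length ≤ L'.length

section evalWord

variable {M : Type*} [Monoid M] (f : ℕ → M)

theorem evalWord_nil : evalWord f [] = 1 := rfl

theorem evalWord_cons (i : ℕ) (L : List ℕ) : evalWord f (i :: L) = f i * evalWord f L := by
  simp [evalWord]

theorem evalWord_append (L L' : List ℕ) :
    evalWord f (L ++ L') = evalWord f L * evalWord f L' := by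
  simp [evalWord]

theorem evalWord_map_succ (L : List ℕ) :
    evalWord f (L.map Nat.succ) = evalWord (fun i => f (i + 1)) L := by
  simp [evalWord, Function.comp_def]

/-- The braid relations. -/
structure IsBraidFamily : Prop where
  braid : ∀ i, f i * f (i + 1) * f i = f (i + 1) * f i * f (i + 1)
  comm : ∀ i j, i + 2 ≤ j → f i * f j = f j * f i

variable {f}

theorem IsBraidFamily.shift (hf : IsBraidFamily f) : IsBraidFamily (fun i => f (i + 1)) :=
  ⟨fun i => hf.braid (i + 1), fun i j h => hf.comm (i + 1) (j + 1) (by omega)⟩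

theorem IsBraidFamily.comm_range (hf : IsBraidFamily f) (m j : ℕ) (h : m + 1 ≤ j) :
    evalWord f (List.range m) * f j = f j * evalWord f (List.range m) := by
  induction m with
  | zero => simp [evalWord]
  | succ m ih =>
    rw [List.range_succ, evalWord_append, evalWord_cons, evalWord_nil, mul_one, mul_assoc,
      hf.comm m j (by omega), ← mul_assoc, ih (by omega), mul_assoc]

theorem IsBraidFamily.range_mul (hf : IsBraidFamily f) (m j : ℕ) (h : j < m) :
    evalWord f (List.range (m + 1)) * f j = f (j + 1) * evalWord f (List.range (m + 1)) := by
  induction m with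
  | zero => omega
  | succ m ih =>
    rw [List.range_succ, evalWord_append, evalWord_cons, evalWord_nil, mul_one]
    by_cases hj : j < m
    · rw [mul_assoc, ← hf.comm j (m + 1) (by omega), ← mul_assoc, ih hj, mul_assoc]
    · obtain rfl : j = m := by omega
      rw [List.range_succ, evalWord_append, evalWord_cons, evalWord_nil, mul_one]
      have h1 := hf.comm_range j (j + 1) le_rfl
      have h2 := hf.braid j
      calc evalWord f (List.range j) * f j * f (j + 1) * f j
          = evalWord f (List.range j) * (f j * f (j + 1) * f j) := by simp only [mul_assoc]
        _ = (evalWord f (List.range j) * f (j + 1)) * f j * f (j + 1) := by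
            rw [h2]; simp only [mul_assoc]
        _ = f (j + 1) * (evalWord f (List.range j) * f j * f (j + 1)) := by
            rw [h1]; simp only [mul_assoc]

theorem IsBraidFamily.range_mul_range (hf : IsBraidFamily f) (m k : ℕ) (h : k ≤ m) :
    evalWord f (List.range (m + 1)) * evalWord f (List.range k) =
      evalWord (fun i => f (i + 1)) (List.range k) * evalWord f (List.range (m + 1)) := by
  induction k with
  | zero => simp [evalWord]
  | succ k ih =>
    rw [List.range_succ (n := k), evalWord_append, evalWord_append, ← mul_assoc, ih (by omega),
      mul_assoc, evalWord_cons, evalWord_nil, mul_one, hf.range_mul m k (by omega), evalWord_cons,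
      evalWord_nil, mul_one, mul_assoc]

theorem IsBraidFamily.comm_shift (hf : IsBraidFamily f) (L : List ℕ) :
    f 0 * evalWord (fun i => f (i + 2)) L = evalWord (fun i => f (i + 2)) L * f 0 := by
  induction L with
  | nil => simp [evalWord]
  | cons i L ih =>
    rw [evalWord_cons, ← mul_assoc, hf.comm 0 (i + 2) (by omega), mul_assoc, ih, mul_assoc]

theorem range_succ_eval (m : ℕ) :
    evalWord f (List.range (m + 1)) = f 0 * evalWord (fun i => f (i + 1)) (List.range m) := by
  rw [List.range_succ_eq_map, evalWord_cons, evalWord_map_succ]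

end evalWord

/-- Lehmer codes of the permutations of `n` letters. -/
def Code : ℕ → Type
  | 0 => Unit
  | n + 1 => Fin (n + 1) × Code n

instance Code.fintype : (n : ℕ) → Fintype (Code n)
  | 0 => inferInstanceAs (Fintype Unit)
  | n + 1 => letI := Code.fintype n; inferInstanceAs (Fintype (Fin (n + 1) × Code n))

/-- The normal form word of a Lehmer code. -/
def Code.word : (n : ℕ) → Code n → List ℕ
  | 0, _ => []
  | n + 1, c => (Code.word n c.2).map Nat.succ ++ List.range c.1

theorem Code.card (n : ℕ) : Fintype.card (Code n) = n.factorial := by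
  induction n with
  | zero => rfl
  | succ n ih =>
    have : Fintype.card (Code (n + 1)) = Fintype.card (Fin (n + 1) × Code n) := rfl
    rw [this, Fintype.card_prod, ih, Fintype.card_fin, Nat.factorial_succ]

theorem Code.word_lt (n : ℕ) (c : Code n) : ∀ i ∈ c.word, i + 1 < n := by
  induction n with
  | zero => intro i hi; simp [Code.word] at hi
  | succ n ih =>
    intro i hi
    simp only [Code.word, List.mem_append, List.mem_map, List.mem_range] at hi
    rcases hi with ⟨j, hj, rfl⟩ | hi
    · have := ih c.2 j hj
      omega
    · have := c.1.2
      omega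

theorem Code.word_two (n : ℕ) (k : Fin (n + 2)) (m : Fin (n + 1)) (r : Code n)
    {M : Type*} [Monoid M] (f : ℕ → M) :
    evalWord f (Code.word (n + 2) (k, (m, r))) = evalWord (fun i => f (i + 2)) r.word *
      evalWord (fun i => f (i + 1)) (List.range m) * evalWord f (List.range k) := by
  simp only [Code.word]
  rw [evalWord_append, evalWord_map_succ, evalWord_append, evalWord_map_succ]

theorem Code.up (n : ℕ) (k : ℕ) (m : ℕ) (hk : k ≤ m) (hm : m < n + 1) (r : Code n)
    {M : Type*} [Monoid M] {f : ℕ → M} (hf : IsBraidFamily f) :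
    evalWord f (Code.word (n + 2) (⟨m + 1, by omega⟩, (⟨k, by omega⟩, r))) =
      f 0 * evalWord f (Code.word (n + 2) (⟨k, by omega⟩, (⟨m, hm⟩, r))) := by
  rw [Code.word_two, Code.word_two]
  simp only
  rw [mul_assoc, ← hf.range_mul_range m k hk, range_succ_eval]
  simp only [← mul_assoc]
  rw [hf.comm_shift]

theorem Code.length_two (n : ℕ) (k : Fin (n + 2)) (m : Fin (n + 1)) (r : Code n) :
    (Code.word (n + 2) (k, (m, r))).length = r.word.length + m + k := by
  simp [Code.word, add_assoc]

/-- Multiplication of a normal form by a letter: the length goes up or down by one. -/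
theorem Code.step {M : Type*} [Monoid M] (n : ℕ) (c : Code n) (i : ℕ) (hi : i + 1 < n)
    (f : ℕ → M) (hf : IsBraidFamily f) : ∃ c' : Code n,
    (evalWord f c'.word = f i * evalWord f c.word ∧ c'.word.length = c.word.length + 1) ∨
    (evalWord f c.word = f i * evalWord f c'.word ∧ c.word.length = c'.word.length + 1) := by
  induction n generalizing i f with
  | zero => omega
  | succ n ih =>
    cases i with
    | succ i =>
      obtain ⟨k, r⟩ := c
      obtain ⟨r', hr'⟩ := ih r i (by omega) (fun i => f (i + 1)) hf.shift
      refine ⟨(k, r'), ?_⟩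
      simp only [Code.word, evalWord_append, evalWord_map_succ, List.length_append, List.length_map]
      rcases hr' with ⟨h1, h2⟩ | ⟨h1, h2⟩
      · left
        rw [h1, h2, mul_assoc]
        exact ⟨rfl, by omega⟩
      · right
        rw [h1, h2, mul_assoc]
        exact ⟨rfl, by omega⟩
    | zero =>
      obtain ⟨n, rfl⟩ : ∃ m, n = m + 1 := ⟨n - 1, by omega⟩
      obtain ⟨⟨k, hk⟩, ⟨⟨m, hm⟩, r⟩⟩ := c
      by_cases h : k ≤ m
      · refine ⟨(⟨m + 1, by omega⟩, (⟨k, by omega⟩, r)), Or.inl ⟨Code.up n k m h hm r hf, ?_⟩⟩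
        rw [Code.length_two, Code.length_two]
        simp only
        omega
      · obtain ⟨k, rfl⟩ : ∃ j, k = j + 1 := ⟨k - 1, by omega⟩
        refine ⟨(⟨m, by omega⟩, (⟨k, by omega⟩, r)), Or.inr ⟨Code.up n m k (by omega) (by omega) r hf,
          ?_⟩⟩
        rw [Code.length_two, Code.length_two]
        simp only
        omega

theorem isBraidFamily_adjSwap : IsBraidFamily adjSwap := by
  constructor
  · intro i
    ext j
    simp only [adjSwap, Equiv.Perm.mul_apply, Equiv.swap_apply_def]
    split_ifs <;> omega
  · intro i j h
    ext l
    simp only [adjSwap, Equiv.Perm.mul_apply, Equiv.swap_apply_def]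
    split_ifs <;> omega

theorem IsBraidFamily.prod {M N : Type*} [Monoid M] [Monoid N] {f : ℕ → M} {g : ℕ → N}
    (hf : IsBraidFamily f) (hg : IsBraidFamily g) : IsBraidFamily (fun i => (f i, g i)) :=
  ⟨fun i => Prod.ext (hf.braid i) (hg.braid i),
    fun i j h => Prod.ext (hf.comm i j h) (hg.comm i j h)⟩

theorem evalWord_prod {M N : Type*} [Monoid M] [Monoid N] (f : ℕ → M) (g : ℕ → N) (L : List ℕ) :
    evalWord (fun i => (f i, g i)) L = (evalWord f L, evalWord g L) := by
  induction L with
  | nil => rfl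
  | cons i L ih => rw [evalWord_cons, ih, evalWord_cons, evalWord_cons]; rfl

theorem adjSwap_mul_self (i : ℕ) : adjSwap i * adjSwap i = 1 := Equiv.swap_mul_self _ _

/-- Every word can be brought to normal form. -/
theorem Code.exists_normalForm {M : Type*} [Monoid M] (n : ℕ) (f : ℕ → M) (hf : IsBraidFamily f)
    (L : List ℕ) (hL : ∀ i ∈ L, i + 1 < n) :
    ∃ c : Code n, evalWord adjSwap c.word = evalWord adjSwap L ∧ c.word.length ≤ L.length ∧
      (c.word.length = L.length → evalWord f c.word = evalWord f L) := by
  induction L with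
  | nil =>
    have key : ∀ n, ∃ c : Code n, c.word = [] := by
      intro n
      induction n with
      | zero => exact ⟨(), rfl⟩
      | succ n ih =>
        obtain ⟨c, hc⟩ := ih
        exact ⟨(0, c), by simp [Code.word, hc]⟩
    obtain ⟨c, hc⟩ := key n
    exact ⟨c, by simp [hc]⟩
  | cons i L ih =>
    obtain ⟨c, h1, h2, h3⟩ := ih (fun j hj => hL j (List.mem_cons_of_mem _ hj))
    obtain ⟨c', hc'⟩ := Code.step n c i (hL i List.mem_cons_self) _
      (hf.prod isBraidFamily_adjSwap)
    simp only [evalWord_prod, Prod.mk_mul_mk, Prod.mk.injEq] at hc'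
    refine ⟨c', ?_⟩
    rw [evalWord_cons, evalWord_cons, List.length_cons]
    rcases hc' with ⟨⟨h4, h5⟩, h6⟩ | ⟨⟨h4, h5⟩, h6⟩
    · rw [h4, h5, h6, h1]
      refine ⟨rfl, by omega, fun h => ?_⟩
      rw [h3 (by omega)]
    · refine ⟨?_, by omega, fun h => by omega⟩
      rw [← h1, h5, ← mul_assoc, adjSwap_mul_self, one_mul]

theorem evalWord_adjSwap_range (k : ℕ) : evalWord adjSwap (List.range k) k = 0 := by
  induction k with
  | zero => rfl
  | succ k ih =>
    rw [List.range_succ, evalWord_append, Equiv.Perm.mul_apply, evalWord_cons, evalWord_nil,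
      mul_one, adjSwap, Equiv.swap_apply_right, ih]

theorem evalWord_adjSwap_shift (L : List ℕ) :
    evalWord (fun i => adjSwap (i + 1)) L 0 = 0 ∧
      ∀ j, evalWord (fun i => adjSwap (i + 1)) L (j + 1) = evalWord adjSwap L j + 1 := by
  induction L with
  | nil => exact ⟨rfl, fun j => rfl⟩
  | cons i L ih =>
    constructor
    · rw [evalWord_cons, Equiv.Perm.mul_apply, ih.1, adjSwap, Equiv.swap_apply_def]
      simp
    · intro j
      rw [evalWord_cons, Equiv.Perm.mul_apply, ih.2, evalWord_cons, Equiv.Perm.mul_apply,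
        adjSwap, adjSwap, Equiv.swap_apply_def, Equiv.swap_apply_def]
      split_ifs <;> omega

theorem Code.word_injective (n : ℕ) (c c' : Code n)
    (h : evalWord adjSwap c.word = evalWord adjSwap c'.word) : c = c' := by
  induction n with
  | zero => exact Subsingleton.elim (α := Unit) _ _
  | succ n ih =>
    obtain ⟨⟨k, hk⟩, r⟩ := c
    obtain ⟨⟨k', hk'⟩, r'⟩ := c'
    have e : ∀ (k : ℕ) (hk : k < n + 1) (r : Code n),
        evalWord adjSwap (Code.word (n + 1) (⟨k, hk⟩, r)) k = 0 := by
      intro k hk r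
      simp only [Code.word]
      rw [evalWord_append, Equiv.Perm.mul_apply, evalWord_adjSwap_range, evalWord_map_succ,
        (evalWord_adjSwap_shift _).1]
    have e1 := e k hk r
    rw [h, ← e k' hk' r'] at e1
    obtain rfl : k = k' := Equiv.injective _ e1
    simp only [Code.word, evalWord_append, evalWord_map_succ, mul_left_inj] at h
    rw [ih r r' ?_]
    ext j
    have := (evalWord_adjSwap_shift r.word).2 j
    rw [h, (evalWord_adjSwap_shift r'.word).2 j] at this
    omega

theorem evalWord_adjSwap_of_le (n : ℕ) (L : List ℕ) (hL : ∀ i ∈ L, i + 1 < n) (j : ℕ)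
    (hj : n ≤ j) : evalWord adjSwap L j = j := by
  induction L with
  | nil => rfl
  | cons i L ih =>
    rw [evalWord_cons, Equiv.Perm.mul_apply, ih (fun l hl => hL l (List.mem_cons_of_mem _ hl))]
    have := hL i List.mem_cons_self
    rw [adjSwap, Equiv.swap_apply_of_ne_of_ne] <;> omega

theorem IsWordOf.eval_eq {n : ℕ} {s : Equiv.Perm (Fin n)} {L L' : List ℕ} (h : IsWordOf n s L)
    (h' : IsWordOf n s L') : evalWord adjSwap L = evalWord adjSwap L' := by
  ext j
  by_cases hj : j < n
  · rw [← h.2 ⟨j, hj⟩, ← h'.2 ⟨j, hj⟩]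
  · rw [evalWord_adjSwap_of_le n L h.1 j (by omega), evalWord_adjSwap_of_le n L' h'.1 j (by omega)]

theorem exists_isWordOf (n : ℕ) (s : Equiv.Perm (Fin n)) : ∃ L, IsWordOf n s L := by
  cases n with
  | zero => exact ⟨[], by simp, fun j => j.elim0⟩
  | succ n =>
    have h : s ∈ Submonoid.closure (Set.range fun i : Fin n => Equiv.swap i.castSucc i.succ) := by
      rw [Equiv.Perm.mclosure_swap_castSucc_succ]; trivial
    obtain ⟨l, hl, rfl⟩ := Submonoid.exists_list_of_mem_closure h
    clear h
    induction l with
    | nil => exact ⟨[], by simp, fun j => rfl⟩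
    | cons t l ih =>
      obtain ⟨L, hL, hL'⟩ := ih (fun y hy => hl y (List.mem_cons_of_mem _ hy))
      obtain ⟨i, rfl⟩ := hl t List.mem_cons_self
      refine ⟨i :: L, ?_, ?_⟩
      · intro j hj
        rcases List.mem_cons.1 hj with rfl | hj
        · have := i.2; omega
        · exact hL j hj
      · intro j
        rw [List.prod_cons, Equiv.Perm.mul_apply, evalWord_cons, Equiv.Perm.mul_apply, ← hL',
          adjSwap, Equiv.swap_apply_def, Equiv.swap_apply_def]
        simp only [Fin.ext_iff]
        split_ifs <;> simp_all

theorem exists_isReducedWordOf (n : ℕ) (s : Equiv.Perm (Fin n)) : ∃ L, IsReducedWordOf n s L := by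
  classical
  have h : ∃ m, ∃ L, IsWordOf n s L ∧ L.length = m := by
    obtain ⟨L, hL⟩ := exists_isWordOf n s
    exact ⟨_, L, hL, rfl⟩
  obtain ⟨L, hL, hm⟩ := Nat.find_spec h
  exact ⟨L, hL, fun L' hL' => hm ▸ Nat.find_min' h ⟨L', hL', rfl⟩⟩

/-- A reduced word for the permutation `s`. -/
noncomputable def reducedWord (n : ℕ) (s : Equiv.Perm (Fin n)) : List ℕ :=
  Classical.choose (exists_isReducedWordOf n s)

theorem reducedWord_spec (n : ℕ) (s : Equiv.Perm (Fin n)) :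
    IsReducedWordOf n s (reducedWord n s) :=
  Classical.choose_spec (exists_isReducedWordOf n s)

theorem exists_code (n : ℕ) (s : Equiv.Perm (Fin n)) : ∃ c : Code n, IsWordOf n s c.word := by
  obtain ⟨L, hL⟩ := exists_isWordOf n s
  obtain ⟨c, hc, -⟩ := Code.exists_normalForm n adjSwap isBraidFamily_adjSwap L hL.1
  exact ⟨c, c.word_lt, fun j => by rw [hc, hL.2]⟩

/-- The Lehmer code of a permutation. -/
noncomputable def toCode (n : ℕ) (s : Equiv.Perm (Fin n)) : Code n :=
  Classical.choose (exists_code n s)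

theorem toCode_spec (n : ℕ) (s : Equiv.Perm (Fin n)) : IsWordOf n s (toCode n s).word :=
  Classical.choose_spec (exists_code n s)

theorem toCode_bijective (n : ℕ) : Function.Bijective (toCode n) := by
  rw [Fintype.bijective_iff_injective_and_card]
  constructor
  · intro s t h
    ext j
    rw [(toCode_spec n s).2 j, (toCode_spec n t).2 j, h]
  · rw [Code.card, Fintype.card_perm, Fintype.card_fin]

theorem IsReducedWordOf.exists_code {M : Type*} [Monoid M] {f : ℕ → M} (hf : IsBraidFamily f)
    {n : ℕ} {s : Equiv.Perm (Fin n)} {L : List ℕ} (hL : IsReducedWordOf n s L) :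
    (toCode n s).word.length = L.length ∧ evalWord f L = evalWord f (toCode n s).word := by
  obtain ⟨c, h1, h2, h3⟩ := Code.exists_normalForm n f hf L hL.1.1
  obtain rfl : c = toCode n s :=
    Code.word_injective n _ _ (h1.trans (hL.1.eval_eq (toCode_spec n s)))
  have h4 : (toCode n s).word.length = L.length := le_antisymm h2 (hL.2 _ (toCode_spec n s))
  exact ⟨h4, (h3 h4).symm⟩

/-- Two reduced words for the same permutation have the same value in every monoid in which the
braid relations hold. -/
theorem IsReducedWordOf.eval_eq {M : Type*} [Monoid M] {f : ℕ → M} (hf : IsBraidFamily f)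
    {n : ℕ} {s : Equiv.Perm (Fin n)} {L L' : List ℕ} (hL : IsReducedWordOf n s L)
    (hL' : IsReducedWordOf n s L') : evalWord f L = evalWord f L' :=
  (hL.exists_code hf).2.trans (hL'.exists_code hf).2.symm

/-- The sum over the symmetric group of the values of reduced words. -/
noncomputable def symSum {A : Type*} [Semiring A] (f : ℕ → A) (n : ℕ) : A :=
  ∑ s : Equiv.Perm (Fin n), evalWord f (reducedWord n s)

theorem symSum_eq {A : Type*} [Semiring A] {f : ℕ → A} (hf : IsBraidFamily f) (n : ℕ)
    (Φ : List ℕ → List ℕ) (σ : Equiv.Perm (Fin n) → Equiv.Perm (Fin n))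
    (hσ : Function.Involutive σ) (hΦ : ∀ L, (Φ L).length = L.length)
    (hw : ∀ s L, IsWordOf n s L → IsWordOf n (σ s) (Φ L)) :
    symSum f n = ∑ c : Code n, evalWord f (Φ c.word) := by
  rw [← (toCode_bijective n).sum_comp, symSum, ← hσ.bijective.sum_comp]
  refine Finset.sum_congr rfl fun s _ => ?_
  have h1 := reducedWord_spec n s
  have h2 := (h1.exists_code hf).1
  refine (reducedWord_spec n (σ s)).eval_eq hf ⟨hw _ _ (toCode_spec n s), fun L' hL' => ?_⟩
  have h3 := h1.2 _ (hσ s ▸ hw _ _ hL')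
  rw [hΦ] at h3 ⊢
  omega

theorem symSum_eq_code {A : Type*} [Semiring A] {f : ℕ → A} (hf : IsBraidFamily f) (n : ℕ) :
    symSum f n = ∑ c : Code n, evalWord f c.word :=
  symSum_eq hf n id id (fun _ => rfl) (fun _ => rfl) (fun _ _ h => h)

theorem Code.sum_succ {A : Type*} [AddCommMonoid A] (n : ℕ) (F : Code (n + 1) → A) :
    ∑ c, F c = ∑ k : Fin (n + 1), ∑ r : Code n, F (k, r) :=
  Fintype.sum_prod_type (α₁ := Fin (n + 1)) (α₂ := Code n) F

theorem symSum_succ {A : Type*} [Semiring A] {f : ℕ → A} (hf : IsBraidFamily f) (n : ℕ) :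
    symSum f (n + 1) = symSum (fun i => f (i + 1)) n *
      ∑ k ∈ Finset.range (n + 1), evalWord f (List.range k) := by
  rw [symSum_eq_code hf, symSum_eq_code hf.shift, Code.sum_succ, Finset.sum_range,
    Finset.mul_sum]
  refine Finset.sum_congr rfl fun k _ => ?_
  rw [Finset.sum_mul]
  refine Finset.sum_congr rfl fun r _ => ?_
  simp only [Code.word]
  rw [evalWord_append, evalWord_map_succ]

theorem IsWordOf.reverse {n : ℕ} {s : Equiv.Perm (Fin n)} {L : List ℕ} (h : IsWordOf n s L) :
    IsWordOf n s⁻¹ L.reverse := by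
  refine ⟨fun i hi => h.1 i (List.mem_reverse.1 hi), fun j => ?_⟩
  have key : evalWord adjSwap L.reverse = (evalWord adjSwap L)⁻¹ := by
    have h1 : ∀ i, (adjSwap i)⁻¹ = adjSwap i := fun i => Equiv.swap_inv _ _
    simp [evalWord, List.prod_inv_reverse, Function.comp_def, h1]
  rw [key, Equiv.Perm.eq_inv_iff_eq, ← h.2]
  simp

theorem symSum_succ_left {A : Type*} [Semiring A] {f : ℕ → A} (hf : IsBraidFamily f) (n : ℕ) :
    symSum f (n + 1) = (∑ k ∈ Finset.range (n + 1), evalWord f (List.range k).reverse) *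
      symSum (fun i => f (i + 1)) n := by
  rw [symSum_eq hf (n + 1) List.reverse (·⁻¹) inv_involutive (fun _ => List.length_reverse)
      (fun _ _ h => h.reverse),
    symSum_eq hf.shift n List.reverse (·⁻¹) inv_involutive (fun _ => List.length_reverse)
      (fun _ _ h => h.reverse), Code.sum_succ, Finset.sum_range, Finset.sum_mul]
  refine Finset.sum_congr rfl fun k _ => ?_
  rw [Finset.mul_sum]
  refine Finset.sum_congr rfl fun r _ => ?_
  simp only [Code.word]
  rw [List.reverse_append, evalWord_append, ← List.map_reverse, evalWord_map_succ]

/-- The image of a word under the diagram automorphism, read backwards. -/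
def flipWord (n : ℕ) (L : List ℕ) : List ℕ := (L.map fun i => n - 2 - i).reverse

theorem IsWordOf.flip {n : ℕ} {s : Equiv.Perm (Fin n)} {L : List ℕ} (h : IsWordOf n s L) :
    IsWordOf n (Fin.revPerm * s⁻¹ * Fin.revPerm) (flipWord n L) := by
  have h' : IsWordOf n (Fin.revPerm * s * Fin.revPerm) (L.map fun i => n - 2 - i) := by
    refine ⟨fun i hi => ?_, fun j => ?_⟩
    · obtain ⟨l, hl, rfl⟩ := List.mem_map.1 hi
      have := h.1 l hl
      omega
    · have key : ∀ L : List ℕ, (∀ i ∈ L, i + 1 < n) → ∀ j < n,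
          evalWord adjSwap L j < n ∧ evalWord adjSwap (L.map fun i => n - 2 - i) (n - 1 - j) =
            n - 1 - evalWord adjSwap L j := by
        intro L hL
        induction L with
        | nil => exact fun j hj => ⟨hj, rfl⟩
        | cons i L ih =>
          intro j hj
          obtain ⟨h1, h2⟩ := ih (fun l hl => hL l (List.mem_cons_of_mem _ hl)) j hj
          have h3 := hL i List.mem_cons_self
          rw [List.map_cons, evalWord_cons, evalWord_cons, Equiv.Perm.mul_apply,
            Equiv.Perm.mul_apply, h2, adjSwap, adjSwap, Equiv.swap_apply_def, Equiv.swap_apply_def]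
          constructor <;> split_ifs <;> omega
      have h1 := (key L h.1 (Fin.rev j) (Fin.rev j).2).2
      rw [← h.2] at h1
      simp only [Equiv.Perm.mul_apply, Fin.revPerm_apply, Fin.val_rev] at h1 ⊢
      have e : n - 1 - (n - (j + 1)) = (j : ℕ) := by omega
      rw [e] at h1
      rw [h1]
      omega
  have h2 := h'.reverse
  have e : (Fin.revPerm * s * Fin.revPerm)⁻¹ = Fin.revPerm * s⁻¹ * (Fin.revPerm : Equiv.Perm (Fin n)) := by
    have : (Fin.revPerm : Equiv.Perm (Fin n))⁻¹ = Fin.revPerm := Fin.revPerm_symm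
    simp only [mul_inv_rev, this, mul_assoc]
  rw [e] at h2
  exact h2

theorem symSum_succ_right {A : Type*} [Semiring A] {f : ℕ → A} (hf : IsBraidFamily f) (n : ℕ) :
    symSum f (n + 1) = (∑ k ∈ Finset.range (n + 1), evalWord f (flipWord (n + 1) (List.range k))) *
      symSum f n := by
  have inv : ∀ n : ℕ, Function.Involutive
      (fun s : Equiv.Perm (Fin n) => Fin.revPerm * s⁻¹ * Fin.revPerm) := by
    intro n s
    have h1 : (Fin.revPerm : Equiv.Perm (Fin n))⁻¹ = Fin.revPerm := Fin.revPerm_symm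
    have h2 : (Fin.revPerm : Equiv.Perm (Fin n)) * Fin.revPerm = 1 := by
      rw [← eq_inv_iff_mul_eq_one, h1]
    simp only [mul_inv_rev, h1, inv_inv, mul_assoc, h2, mul_one]
    simp only [← mul_assoc, h2, one_mul]
  rw [symSum_eq hf (n + 1) (flipWord (n + 1)) _ (inv _) (by simp [flipWord])
      (fun _ _ h => h.flip),
    symSum_eq hf n (flipWord n) _ (inv _) (by simp [flipWord])
      (fun _ _ h => h.flip), Code.sum_succ, Finset.sum_range, Finset.sum_mul]
  refine Finset.sum_congr rfl fun k _ => ?_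
  rw [Finset.mul_sum]
  refine Finset.sum_congr rfl fun r _ => ?_
  simp only [Code.word, flipWord]
  rw [List.map_append, List.reverse_append, evalWord_append, List.map_map]
  congr 4
  funext i
  simp only [Function.comp]
  omega

end RackNichols

namespace RackNichols

/-! ### The tensor algebra of the braided vector space -/

variable (k : Type*) [Field k] (X : Type*)

/-- The tensor algebra `T(V)` of the vector space `V` with basis `v_x`, `x ∈ X`.  It is the monoid
algebra of the free monoid on `X`: the word `x₁ ⋯ xₙ` is the basis vector
`v_{x₁} ⊗ ⋯ ⊗ v_{xₙ}` of `V^{⊗ n}`, and concatenation is the tensor product. -/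
abbrev TAlg := MonoidAlgebra k (FreeMonoid X)

variable {X}

/-- The basis vector of `T(V)` that belongs to a word. -/
noncomputable def wd (l : List X) : TAlg k X := MonoidAlgebra.single (FreeMonoid.ofList l) 1

/-- The basis vector `v_x` of `V`. -/
noncomputable def vT (x : X) : TAlg k X := wd k [x]

variable {k}

theorem wd_nil : wd k ([] : List X) = 1 := rfl

theorem wd_append (l l' : List X) : wd k (l ++ l') = wd k l * wd k l' := by
  simp [wd, MonoidAlgebra.single_mul_single]

theorem wd_cons (x : X) (l : List X) : wd k (x :: l) = vT k x * wd k l :=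
  wd_append [x] l

/-- The linear map on `T(V)` with given values on the words. -/
noncomputable def wordLift {M : Type*} [AddCommGroup M] [Module k M] (f : List X → M) :
    TAlg k X →ₗ[k] M :=
  (Finsupp.linearCombination k fun w : FreeMonoid X => f w.toList) ∘ₗ
    (MonoidAlgebra.coeffLinearEquiv k).toLinearMap

theorem wordLift_wd {M : Type*} [AddCommGroup M] [Module k M] (f : List X → M) (l : List X) :
    wordLift f (wd k l) = f l := by
  simp [wordLift, wd]

theorem tAlg_hom_ext {M : Type*} [AddCommGroup M] [Module k M] {f g : TAlg k X →ₗ[k] M}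
    (h : ∀ l, f (wd k l) = g (wd k l)) : f = g := by
  ext l
  exact h l

variable (k X) in
/-- The homogeneous component `T(V)(n) = V^{⊗ n}`. -/
noncomputable def tensorPower (n : ℕ) : Submodule k (TAlg k X) :=
  Submodule.span k (wd k '' {l : List X | l.length = n})

theorem wd_mem (l : List X) : wd k l ∈ tensorPower k X l.length :=
  Submodule.subset_span ⟨l, rfl, rfl⟩

/-- The linear map that is `F n` on `T(V)(n)`. -/
noncomputable def glue (F : ℕ → Module.End k (TAlg k X)) : Module.End k (TAlg k X) :=
  wordLift fun l => F l.length (wd k l)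

theorem glue_wd (F : ℕ → Module.End k (TAlg k X)) (l : List X) :
    glue F (wd k l) = F l.length (wd k l) := wordLift_wd _ _

theorem glue_of_mem (F : ℕ → Module.End k (TAlg k X)) {n : ℕ} {t : TAlg k X}
    (ht : t ∈ tensorPower k X n) : glue F t = F n t := by
  induction ht using Submodule.span_induction with
  | mem x h => obtain ⟨l, rfl, rfl⟩ := h; exact glue_wd _ _
  | zero => simp
  | add x y _ _ hx hy => rw [map_add, map_add, hx, hy]
  | smul a x _ hx => rw [map_smul, map_smul, hx]

theorem vT_mul_mem (x : X) {n : ℕ} {t : TAlg k X} (ht : t ∈ tensorPower k X n) :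
    vT k x * t ∈ tensorPower k X (n + 1) := by
  induction ht using Submodule.span_induction with
  | mem y h => obtain ⟨l, rfl, rfl⟩ := h; rw [← wd_cons]; exact wd_mem (x :: l)
  | zero => simp
  | add y z _ _ hy hz => rw [mul_add]; exact add_mem hy hz
  | smul a y _ hy => rw [mul_smul_comm]; exact Submodule.smul_mem _ _ hy

theorem mul_vT_mem (x : X) {n : ℕ} {t : TAlg k X} (ht : t ∈ tensorPower k X n) :
    t * vT k x ∈ tensorPower k X (n + 1) := by
  induction ht using Submodule.span_induction with
  | mem y h =>
    obtain ⟨l, rfl, rfl⟩ := h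
    rw [vT, ← wd_append]
    have := wd_mem (k := k) (l ++ [x])
    simpa using this
  | zero => simp
  | add y z _ _ hy hz => rw [add_mul]; exact add_mem hy hz
  | smul a y _ hy => rw [smul_mul_assoc]; exact Submodule.smul_mem _ _ hy

theorem tAlg_induction {p : TAlg k X → Prop} (t : TAlg k X) (h0 : p 0) (hw : ∀ l, p (wd k l))
    (hadd : ∀ s t, p s → p t → p (s + t)) (hsmul : ∀ (a : k) t, p t → p (a • t)) : p t := by
  refine MonoidAlgebra.induction_linear t h0 (fun s t hs ht => hadd s t hs ht) fun l a => ?_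
  have : MonoidAlgebra.single l a = a • wd k l.toList := by simp [wd]
  rw [this]
  exact hsmul _ _ (hw _)

open scoped TensorProduct in
theorem tAlg_tensor_ext {M : Type*} [AddCommGroup M] [Module k M]
    {f g : TAlg k X ⊗[k] TAlg k X →ₗ[k] M}
    (h : ∀ l l', f (wd k l ⊗ₜ wd k l') = g (wd k l ⊗ₜ wd k l')) (z : TAlg k X ⊗[k] TAlg k X) :
    f z = g z := by
  have : f = g := by
    refine TensorProduct.ext (tAlg_hom_ext fun l => tAlg_hom_ext fun l' => ?_)
    exact h l l'
  rw [this]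

/-- The projection of `T(V)` onto `T(V)(n)`. -/
noncomputable def projT (n : ℕ) : Module.End k (TAlg k X) :=
  wordLift fun l => if l.length = n then wd k l else 0

theorem projT_wd (n : ℕ) (l : List X) :
    projT n (wd k l) = if l.length = n then wd k l else 0 := wordLift_wd _ _

theorem projT_zero_mul (x : X) (t : TAlg k X) : projT 0 (vT k x * t) = 0 := by
  have : projT 0 ∘ₗ LinearMap.mulLeft k (vT k x) = 0 :=
    tAlg_hom_ext fun l => by simp [← wd_cons, projT_wd]
  exact LinearMap.congr_fun this t

theorem projT_succ_mul (n : ℕ) (x : X) (t : TAlg k X) :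
    projT (n + 1) (vT k x * t) = vT k x * projT n t := by
  have : projT (n + 1) ∘ₗ LinearMap.mulLeft k (vT k x) =
      LinearMap.mulLeft k (vT k x) ∘ₗ projT n :=
    tAlg_hom_ext fun l => by
      by_cases h : l.length = n <;> simp [← wd_cons, projT_wd, h]
  exact LinearMap.congr_fun this t

open scoped TensorProduct in
/-- Cutting a word after `i` letters; words that are too short are sent to `0`. -/
noncomputable def splitWord : ℕ → List X → TAlg k X ⊗[k] TAlg k X
  | 0, l => 1 ⊗ₜ wd k l
  | _ + 1, [] => 0
  | i + 1, x :: l => TensorProduct.map (LinearMap.mulLeft k (vT k x)) LinearMap.id (splitWord i l)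

open scoped TensorProduct in
theorem wordLift_splitWord_mul (i : ℕ) (x : X) (t : TAlg k X) :
    wordLift (splitWord (i + 1)) (vT k x * t) =
      TensorProduct.map (LinearMap.mulLeft k (vT k x)) LinearMap.id
        (wordLift (splitWord i) t) := by
  have : wordLift (splitWord (i + 1)) ∘ₗ LinearMap.mulLeft k (vT k x) =
      TensorProduct.map (LinearMap.mulLeft k (vT k x)) LinearMap.id ∘ₗ wordLift (splitWord i) :=
    tAlg_hom_ext fun l => by simp [← wd_cons, wordLift_wd, splitWord]
  exact LinearMap.congr_fun this t

variable (k X) in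
open scoped TensorProduct in
/-- The map `r ⊗ (s ⊗ t) ↦ rs ⊗ t`. -/
noncomputable def mulFirst : TAlg k X ⊗[k] (TAlg k X ⊗[k] TAlg k X) →ₗ[k] TAlg k X ⊗[k] TAlg k X :=
  TensorProduct.map (LinearMap.mul' k (TAlg k X)) LinearMap.id ∘ₗ
    (TensorProduct.assoc k _ _ _).symm.toLinearMap

open scoped TensorProduct in
theorem mulFirst_tmul (s : TAlg k X) (z : TAlg k X ⊗[k] TAlg k X) :
    mulFirst k X (s ⊗ₜ z) = TensorProduct.map (LinearMap.mulLeft k s) LinearMap.id z := by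
  induction z with
  | zero => simp
  | add z w hz hw => rw [TensorProduct.tmul_add, map_add, map_add, hz, hw]
  | tmul t u => simp [mulFirst]

open scoped TensorProduct in
theorem mulFirst_assoc (f g h : Module.End k (TAlg k X))
    (z : (TAlg k X ⊗[k] TAlg k X) ⊗[k] TAlg k X) :
    mulFirst k X (TensorProduct.map f (TensorProduct.map g h) (TensorProduct.assoc k _ _ _ z)) =
    TensorProduct.map (LinearMap.mul' k (TAlg k X) ∘ₗ TensorProduct.map f g) h z := by
  induction z with
  | zero => simp
  | add z w hz hw => simp only [map_add, hz, hw]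
  | tmul z w =>
    induction z with
    | zero => simp
    | add z z' hz hz' => simp only [TensorProduct.add_tmul, map_add, hz, hz']
    | tmul s t => simp [mulFirst]

open scoped TensorProduct in
theorem splitWord_mulT (i : ℕ) (F : Module.End k (TAlg k X)) (z : TAlg k X ⊗[k] TAlg k X) :
    wordLift (splitWord (i + 1))
        (LinearMap.mul' k (TAlg k X) (TensorProduct.map (projT 1) F z)) =
      mulFirst k X (TensorProduct.map (projT 1) (wordLift (splitWord i) ∘ₗ F) z) := by
  have key : ∀ (l₁ : List X) (t : TAlg k X),
      wordLift (splitWord (i + 1)) (projT 1 (wd k l₁) * t) =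
        mulFirst k X (projT 1 (wd k l₁) ⊗ₜ wordLift (splitWord i) t) := by
    intro l₁ t
    rw [mulFirst_tmul, projT_wd]
    match l₁ with
    | [] => simp
    | [y] =>
      rw [if_pos (List.length_singleton (a := y))]
      exact wordLift_splitWord_mul i y t
    | y :: y' :: l => simp
  have h : wordLift (splitWord (i + 1)) ∘ₗ LinearMap.mul' k (TAlg k X) ∘ₗ
      TensorProduct.map (projT 1) F =
      mulFirst k X ∘ₗ TensorProduct.map (projT 1) (wordLift (splitWord i) ∘ₗ F) := by
    refine LinearMap.ext (tAlg_tensor_ext fun l₁ l₂ => ?_)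
    rw [LinearMap.comp_apply, LinearMap.comp_apply, LinearMap.comp_apply, TensorProduct.map_tmul,
      TensorProduct.map_tmul, LinearMap.mul'_apply, LinearMap.comp_apply, key]
  exact LinearMap.congr_fun h z

open scoped TensorProduct in
theorem exists_projT_sum (z : TAlg k X ⊗[k] TAlg k X) : ∃ N, ∀ n, N ≤ n →
    TensorProduct.map (∑ i ∈ Finset.range n, projT i) LinearMap.id z = z := by
  induction z with
  | zero => exact ⟨0, fun _ _ => map_zero _⟩
  | add z w hz hw =>
    obtain ⟨N, hN⟩ := hz
    obtain ⟨N', hN'⟩ := hw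
    exact ⟨max N N', fun n hn => by
      rw [map_add, hN n (le_trans (le_max_left _ _) hn), hN' n (le_trans (le_max_right _ _) hn)]⟩
  | tmul s t =>
    have : ∃ N, ∀ n, N ≤ n → (∑ i ∈ Finset.range n, projT i : Module.End k (TAlg k X)) s = s := by
      refine tAlg_induction (p := fun s => ∃ N, ∀ n, N ≤ n →
        (∑ i ∈ Finset.range n, projT i : Module.End k (TAlg k X)) s = s) s ⟨0, fun _ _ => map_zero _⟩
        (fun l => ⟨l.length + 1, fun n hn => ?_⟩) ?_ ?_
      · rw [LinearMap.sum_apply]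
        simp only [projT_wd]
        rw [Finset.sum_ite_eq, if_pos (Finset.mem_range.2 (by omega))]
      · rintro s t ⟨N, hN⟩ ⟨N', hN'⟩
        exact ⟨max N N', fun n hn => by
          rw [map_add, hN n (le_trans (le_max_left _ _) hn),
            hN' n (le_trans (le_max_right _ _) hn)]⟩
      · rintro a s ⟨N, hN⟩
        exact ⟨N, fun n hn => by rw [map_smul, hN n hn]⟩
    obtain ⟨N, hN⟩ := this
    exact ⟨N, fun n hn => by rw [TensorProduct.map_tmul, hN n hn]; rfl⟩

end RackNichols

namespace RackNichols

open scoped Quandles TensorProduct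

/-- A scalar valued two-cocycle on a rack. -/
structure TwoCocycle (k X : Type*) [Field k] [Rack X] where
  /-- The family `q_{x,y}` of non-zero scalars. -/
  toFun : X → X → kˣ
  cocycle : ∀ x y z, toFun (x ◃ y) (x ◃ z) * toFun x z = toFun x (y ◃ z) * toFun y z

variable {k : Type*} [Field k] {X : Type*} [Rack X] (q : TwoCocycle k X)

theorem TwoCocycle.cocycle' (x y z : X) :
    ((q.toFun (x ◃ y) (x ◃ z) : kˣ) : k) * (q.toFun x z : k) =
      (q.toFun x (y ◃ z) : k) * (q.toFun y z : k) := by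
  exact_mod_cast congrArg Units.val (q.cocycle x y z)

/-- The braiding `c_q(v_x ⊗ v_y) = q_{x,y} v_{x ▷ y} ⊗ v_x`, applied to a word at the letters with
the positions `i` and `i + 1`, where positions are counted from `0`.
(On words that are too short for this the value is `0`.) -/
noncomputable def braidWord : ℕ → List X → TAlg k X
  | 0, x :: y :: l => (q.toFun x y : k) • wd k ((x ◃ y) :: x :: l)
  | 0, [_] => 0
  | 0, [] => 0
  | i + 1, x :: l => vT k x * braidWord i l
  | _ + 1, [] => 0

/-- The linear map `c_{i+1}` on `V^{⊗ n}` (for all `n ≥ i + 2`): apply the braiding `c_q` to the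
tensor factors with the positions `i` and `i + 1`, counted from `0`. -/
noncomputable def braid (i : ℕ) : Module.End k (TAlg k X) := wordLift (braidWord q i)

theorem braid_wd (i : ℕ) (l : List X) : braid q i (wd k l) = braidWord q i l := wordLift_wd _ _

theorem braid_zero_wd (x y : X) (l : List X) :
    braid q 0 (wd k (x :: y :: l)) = (q.toFun x y : k) • wd k ((x ◃ y) :: x :: l) := braid_wd _ _ _

theorem braid_succ_wd (i : ℕ) (x : X) (l : List X) :
    braid q (i + 1) (wd k (x :: l)) = vT k x * braid q i (wd k l) := by
  rw [braid_wd, braid_wd]; rfl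

theorem braid_nil (i : ℕ) : braid q i (wd k []) = 0 := by
  rw [braid_wd]; cases i <;> rfl

theorem braid_zero_single (x : X) : braid q 0 (wd k [x]) = 0 := braid_wd _ _ _

theorem braid_succ_mul (i : ℕ) (x : X) (t : TAlg k X) :
    braid q (i + 1) (vT k x * t) = vT k x * braid q i t := by
  have : braid q (i + 1) ∘ₗ LinearMap.mulLeft k (vT k x) =
      LinearMap.mulLeft k (vT k x) ∘ₗ braid q i := tAlg_hom_ext fun l => by
    simp [← wd_cons, braid_succ_wd]
  exact LinearMap.congr_fun this t

theorem isBraidFamily_braid : IsBraidFamily (braid q) := by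
  constructor
  · intro i
    induction i with
    | zero =>
      refine tAlg_hom_ext fun l => ?_
      simp only [Module.End.mul_apply]
      match l with
      | [] => simp [braid_nil]
      | [x] => simp [braid_zero_single, braid_succ_wd, braid_nil]
      | [x, y] => simp [braid_zero_single, braid_zero_wd, braid_succ_wd]
      | x :: y :: z :: l =>
        simp only [braid_zero_wd, braid_succ_wd, map_smul, mul_smul_comm, smul_smul, ← wd_cons]
        rw [Shelf.self_distrib (x := x) (y := y) (z := z)]
        congr 1
        have := q.cocycle' x y z
        linear_combination (q.toFun x y : k) * this
    | succ i ih =>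
      refine tAlg_hom_ext fun l => ?_
      have h := fun l => LinearMap.congr_fun ih (wd k l)
      simp only [Module.End.mul_apply] at h ⊢
      match l with
      | [] => simp [braid_nil]
      | x :: l => simp only [wd_cons, braid_succ_mul, h]
  · intro i j hij
    induction i generalizing j with
    | zero =>
      obtain ⟨j, rfl⟩ : ∃ m, j = m + 2 := ⟨j - 2, by omega⟩
      refine tAlg_hom_ext fun l => ?_
      simp only [Module.End.mul_apply]
      match l with
      | [] => simp [braid_nil]
      | [x] => simp [braid_zero_single, braid_succ_wd, braid_nil]
      | x :: y :: l =>
        have h0 : ∀ t : TAlg k X, braid q 0 (vT k x * (vT k y * t)) =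
            (q.toFun x y : k) • (vT k (x ◃ y) * (vT k x * t)) := by
          intro t
          have : braid q 0 ∘ₗ LinearMap.mulLeft k (vT k x) ∘ₗ LinearMap.mulLeft k (vT k y) =
              (q.toFun x y : k) •
                (LinearMap.mulLeft k (vT k (x ◃ y)) ∘ₗ LinearMap.mulLeft k (vT k x)) :=
            tAlg_hom_ext fun l => by simp [← wd_cons, braid_zero_wd]
          exact LinearMap.congr_fun this t
        simp only [wd_cons, braid_succ_mul, h0, map_smul]
    | succ i ih =>
      obtain ⟨j, rfl⟩ : ∃ m, j = m + 1 := ⟨j - 1, by omega⟩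
      refine tAlg_hom_ext fun l => ?_
      have h := fun l => LinearMap.congr_fun (ih j (by omega)) (wd k l)
      simp only [Module.End.mul_apply] at h ⊢
      match l with
      | [] => simp [braid_nil]
      | x :: l => simp only [wd_cons, braid_succ_mul, h]

/-- The braided symmetrizer `S_n = ∑_{s ∈ 𝕊_n} τ(ν(s))` on `V^{⊗ n}`: the Matsumoto section `ν`
replaces the transpositions in a reduced word for `s` by the generators of the braid group, which
act by the maps `braid q i`. -/
noncomputable def braidedSymmetrizer (n : ℕ) : Module.End k (TAlg k X) :=
  ∑ s : Equiv.Perm (Fin n), evalWord (braid q) (reducedWord n s)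

theorem braidedSymmetrizer_eq (n : ℕ) : braidedSymmetrizer q n = symSum (braid q) n := rfl

theorem braidWord_mem (i : ℕ) (l : List X) : braidWord q i l ∈ tensorPower k X l.length := by
  induction i generalizing l with
  | zero =>
    match l with
    | [] => exact zero_mem _
    | [x] => exact zero_mem _
    | x :: y :: l => exact Submodule.smul_mem _ _ (wd_mem ((x ◃ y) :: x :: l))
  | succ i ih =>
    match l with
    | [] => exact zero_mem _
    | x :: l => exact vT_mul_mem x (ih l)

theorem braid_mem (i : ℕ) {n : ℕ} {t : TAlg k X} (ht : t ∈ tensorPower k X n) :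
    braid q i t ∈ tensorPower k X n := by
  induction ht using Submodule.span_induction with
  | mem y h => obtain ⟨l, rfl, rfl⟩ := h; rw [braid_wd]; exact braidWord_mem _ _ _
  | zero => simp
  | add y z _ _ hy hz => rw [map_add]; exact add_mem hy hz
  | smul a y _ hy => rw [map_smul]; exact Submodule.smul_mem _ _ hy

theorem evalWord_braid_mem (L : List ℕ) {n : ℕ} {t : TAlg k X} (ht : t ∈ tensorPower k X n) :
    evalWord (braid q) L t ∈ tensorPower k X n := by
  induction L with
  | nil => exact ht
  | cons i L ih => rw [evalWord_cons]; exact braid_mem q i ih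

theorem braidedSymmetrizer_mem (m : ℕ) {n : ℕ} {t : TAlg k X} (ht : t ∈ tensorPower k X n) :
    braidedSymmetrizer q m t ∈ tensorPower k X n := by
  rw [braidedSymmetrizer, LinearMap.sum_apply]
  exact Submodule.sum_mem _ fun s _ => evalWord_braid_mem q _ ht

theorem evalWord_shift_mul (L : List ℕ) (x : X) (t : TAlg k X) :
    evalWord (fun i => braid q (i + 1)) L (vT k x * t) = vT k x * evalWord (braid q) L t := by
  induction L with
  | nil => rfl
  | cons i L ih =>
    rw [evalWord_cons, Module.End.mul_apply, ih, braid_succ_mul, evalWord_cons]; rfl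

theorem symSum_shift_mul (n : ℕ) (x : X) (t : TAlg k X) :
    symSum (fun i => braid q (i + 1)) n (vT k x * t) = vT k x * braidedSymmetrizer q n t := by
  simp only [symSum, braidedSymmetrizer, LinearMap.sum_apply, Finset.mul_sum, evalWord_shift_mul]

theorem braid_mul_vT (i : ℕ) (l : List X) (hi : i + 1 < l.length) (x : X) :
    braid q i (wd k l * vT k x) = braid q i (wd k l) * vT k x := by
  induction i generalizing l with
  | zero =>
    match l with
    | [] => simp at hi
    | [x] => simp at hi
    | y :: z :: l =>
      rw [vT, ← wd_append]
      simp only [List.cons_append, braid_zero_wd, smul_mul_assoc, ← wd_append]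
  | succ i ih =>
    match l with
    | [] => simp at hi
    | y :: l =>
      rw [wd_cons, mul_assoc, braid_succ_mul, braid_succ_mul, ih l (by simpa using hi), mul_assoc]

theorem braid_mul_vT' (i : ℕ) {n : ℕ} (hi : i + 1 < n) {t : TAlg k X}
    (ht : t ∈ tensorPower k X n) (x : X) :
    braid q i (t * vT k x) = braid q i t * vT k x := by
  induction ht using Submodule.span_induction with
  | mem y h => obtain ⟨l, rfl, rfl⟩ := h; exact braid_mul_vT q i l hi x
  | zero => simp
  | add y z _ _ hy hz => rw [add_mul, map_add, map_add, hy, hz, add_mul]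
  | smul a y _ hy => rw [smul_mul_assoc, map_smul, map_smul, hy, smul_mul_assoc]

theorem evalWord_mul_vT (L : List ℕ) {n : ℕ} (hL : ∀ i ∈ L, i + 1 < n) {t : TAlg k X}
    (ht : t ∈ tensorPower k X n) (x : X) :
    evalWord (braid q) L (t * vT k x) = evalWord (braid q) L t * vT k x := by
  induction L with
  | nil => rfl
  | cons i L ih =>
    rw [evalWord_cons, Module.End.mul_apply, ih (fun j hj => hL j (List.mem_cons_of_mem _ hj)),
      braid_mul_vT' q i (hL i List.mem_cons_self) (evalWord_braid_mem q L ht)]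
    rfl

theorem braidedSymmetrizer_mul_vT {n : ℕ} {t : TAlg k X} (ht : t ∈ tensorPower k X n) (x : X) :
    braidedSymmetrizer q n (t * vT k x) = braidedSymmetrizer q n t * vT k x := by
  simp only [braidedSymmetrizer, LinearMap.sum_apply, Finset.sum_mul]
  exact Finset.sum_congr rfl fun s _ => evalWord_mul_vT q _ (reducedWord_spec n s).1.1 ht x

/-- The direct sum of the braided symmetrizers, an endomorphism of `T(V)`. -/
noncomputable def totalSymmetrizer : Module.End k (TAlg k X) := glue (braidedSymmetrizer q)

theorem totalSymmetrizer_vT_mul (x : X) (t : TAlg k X) :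
    totalSymmetrizer q (vT k x * t) =
      glue (fun n => ∑ j ∈ Finset.range n, evalWord (braid q) (List.range j).reverse)
        (vT k x * totalSymmetrizer q t) := by
  have : totalSymmetrizer q ∘ₗ LinearMap.mulLeft k (vT k x) =
      glue (fun n => ∑ j ∈ Finset.range n, evalWord (braid q) (List.range j).reverse) ∘ₗ
        LinearMap.mulLeft k (vT k x) ∘ₗ totalSymmetrizer q := tAlg_hom_ext fun l => by
    simp only [LinearMap.comp_apply, LinearMap.mulLeft_apply]
    rw [totalSymmetrizer, glue_wd,
      glue_of_mem _ (vT_mul_mem x (braidedSymmetrizer_mem q l.length (wd_mem l))),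
      ← wd_cons, glue_wd, List.length_cons, braidedSymmetrizer_eq,
      symSum_succ_left (isBraidFamily_braid q), Module.End.mul_apply, wd_cons, symSum_shift_mul]
  exact LinearMap.congr_fun this t

theorem totalSymmetrizer_mul_vT (x : X) (t : TAlg k X) :
    totalSymmetrizer q (t * vT k x) =
      glue (fun n => ∑ j ∈ Finset.range n, evalWord (braid q) (flipWord n (List.range j)))
        (totalSymmetrizer q t * vT k x) := by
  have : totalSymmetrizer q ∘ₗ LinearMap.mulRight k (vT k x) =
      glue (fun n => ∑ j ∈ Finset.range n, evalWord (braid q) (flipWord n (List.range j))) ∘ₗ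
        LinearMap.mulRight k (vT k x) ∘ₗ totalSymmetrizer q := tAlg_hom_ext fun l => by
    simp only [LinearMap.comp_apply, LinearMap.mulRight_apply]
    have h1 := mul_vT_mem x (wd_mem (k := k) l)
    rw [totalSymmetrizer, glue_wd,
      glue_of_mem _ (mul_vT_mem x (braidedSymmetrizer_mem q l.length (wd_mem l))),
      glue_of_mem _ h1, braidedSymmetrizer_eq,
      symSum_succ_right (isBraidFamily_braid q), Module.End.mul_apply, ← braidedSymmetrizer_eq,
      braidedSymmetrizer_mul_vT q (wd_mem l)]
  exact LinearMap.congr_fun this t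

/-- The ideal `⨁_n ker S_n` of `T(V)`: the kernel of the direct sum of the braided symmetrizers. -/
noncomputable def nicholsIdeal : Ideal (TAlg k X) where
  carrier := {t | totalSymmetrizer q t = 0}
  zero_mem' := map_zero _
  add_mem' := fun {s t} hs ht => by
    change totalSymmetrizer q (s + t) = 0
    rw [map_add, hs, ht, add_zero]
  smul_mem' := fun a t ht => by
    change totalSymmetrizer q (a * t) = 0
    refine tAlg_induction (p := fun a => totalSymmetrizer q (a * t) = 0) a (by simp) (fun l => ?_) (fun r s hr hs => ?_) (fun b s hs => ?_)
    · induction l with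
      | nil => rw [wd_nil, one_mul]; exact ht
      | cons x l ih => rw [wd_cons, mul_assoc, totalSymmetrizer_vT_mul, ih, mul_zero, map_zero]
    · rw [add_mul, map_add, hr, hs, add_zero]
    · rw [smul_mul_assoc, map_smul, hs, smul_zero]

theorem mem_nicholsIdeal {t : TAlg k X} : t ∈ nicholsIdeal q ↔ totalSymmetrizer q t = 0 := Iff.rfl

instance nicholsIdeal_isTwoSided : (nicholsIdeal q).IsTwoSided where
  mul_mem_of_left := fun {t} b ht => by
    rw [mem_nicholsIdeal] at ht ⊢
    refine tAlg_induction (p := fun b => totalSymmetrizer q (t * b) = 0) b (by simp) (fun l => ?_) (fun r s hr hs => ?_) (fun b s hs => ?_)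
    · induction l using List.reverseRecOn with
      | nil => rw [wd_nil, mul_one]; exact ht
      | append_singleton l x ih =>
        rw [wd_append, ← mul_assoc]
        change totalSymmetrizer q (t * wd k l * vT k x) = 0
        rw [totalSymmetrizer_mul_vT, ih, zero_mul, map_zero]
    · rw [mul_add, map_add, hr, hs, add_zero]
    · rw [mul_smul_comm, map_smul, hs, smul_zero]

end RackNichols

namespace RackNichols

open scoped Quandles TensorProduct

variable {k : Type*} [Field k] {X : Type*} [Rack X] (q : TwoCocycle k X)

/-! ### The Nichols algebra -/

/-- The Nichols algebra `𝓑(V) = ⨁_n T(V)(n) / ker S_n`. -/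
abbrev NicholsAlgebra : Type _ := TAlg k X ⧸ nicholsIdeal q

/-- The canonical map `T(V) → 𝓑(V)`; on `V^{⊗ n}` it is the multiplication map `μ` with values in
`𝓑(V)`. -/
noncomputable def toNichols : TAlg k X →ₐ[k] NicholsAlgebra q := Ideal.Quotient.mkₐ k _

theorem toNichols_eq_zero {t : TAlg k X} : toNichols q t = 0 ↔ totalSymmetrizer q t = 0 :=
  Ideal.Quotient.eq_zero_iff_mem

/-- The injective map `𝓑(V) → T(V)` that is induced by the braided symmetrizers. -/
noncomputable def nicholsEmb : NicholsAlgebra q →ₗ[k] TAlg k X :=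
  (Submodule.liftQ ((nicholsIdeal q).restrictScalars k) (totalSymmetrizer q) fun _ h => h) ∘ₗ
    (Submodule.Quotient.restrictScalarsEquiv k (nicholsIdeal q)).symm.toLinearMap

theorem nicholsEmb_comp : nicholsEmb q ∘ₗ (toNichols q).toLinearMap = totalSymmetrizer q := by
  ext l
  rfl

theorem nicholsEmb_injective : Function.Injective (nicholsEmb q) := by
  rw [injective_iff_map_eq_zero]
  intro b hb
  obtain ⟨t, rfl⟩ := Ideal.Quotient.mk_surjective b
  exact (toNichols_eq_zero q).2 hb

/-- A linear map on `T(V)` that vanishes on the ideal descends to the Nichols algebra. -/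
noncomputable def nicholsLift {M : Type*} [AddCommGroup M] [Module k M] (f : TAlg k X →ₗ[k] M)
    (hf : ∀ t, totalSymmetrizer q t = 0 → f t = 0) : NicholsAlgebra q →ₗ[k] M :=
  (Submodule.liftQ ((nicholsIdeal q).restrictScalars k) f fun _ h => hf _ h) ∘ₗ
    (Submodule.Quotient.restrictScalarsEquiv k (nicholsIdeal q)).symm.toLinearMap

theorem nicholsLift_toNichols {M : Type*} [AddCommGroup M] [Module k M] (f : TAlg k X →ₗ[k] M)
    (hf : ∀ t, totalSymmetrizer q t = 0 → f t = 0) (t : TAlg k X) :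
    nicholsLift q f hf (toNichols q t) = f t := rfl

/-! ### The comultiplication -/

/-- The action of the generator `g_x` of the enveloping group on `T(V)`, on words:
`g_x · v_y = q_{x,y} v_{x ▷ y}`, and `g_x` acts by an algebra map. -/
noncomputable def actWord (x : X) : List X → TAlg k X
  | [] => 1
  | y :: l => (q.toFun x y : k) • (vT k (x ◃ y) * actWord x l)

/-- The action of the generator `g_x` of the enveloping group on `T(V)`. -/
noncomputable def act (x : X) : Module.End k (TAlg k X) := wordLift (actWord q x)

/-- Multiplication from the left by `Δ(v_x) = v_x ⊗ 1 + 1 ⊗ v_x` in the braided tensor product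
algebra `T(V) ⊗ T(V)`, where `(1 ⊗ v_x)(s ⊗ t) = g_x · s ⊗ v_x t`. -/
noncomputable def comulStep (x : X) : Module.End k (TAlg k X ⊗[k] TAlg k X) :=
  TensorProduct.map (LinearMap.mulLeft k (vT k x)) LinearMap.id +
    TensorProduct.map (act q x) (LinearMap.mulLeft k (vT k x))

/-- The comultiplication of `T(V)` on words: `Δ(1) = 1 ⊗ 1` and `Δ(v_x t) = Δ(v_x) Δ(t)`. -/
noncomputable def comulWord : List X → TAlg k X ⊗[k] TAlg k X
  | [] => 1 ⊗ₜ 1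
  | x :: l => comulStep q x (comulWord l)

/-- The comultiplication of the braided Hopf algebra `T(V)`. -/
noncomputable def comulT : TAlg k X →ₗ[k] TAlg k X ⊗[k] TAlg k X := wordLift (comulWord q)

theorem act_nil (x : X) : act q x (wd k []) = 1 := wordLift_wd _ _

theorem act_cons (x y : X) (l : List X) :
    act q x (wd k (y :: l)) = (q.toFun x y : k) • (vT k (x ◃ y) * act q x (wd k l)) := by
  rw [act, wordLift_wd, wordLift_wd]; rfl

theorem act_mul (x y : X) (t : TAlg k X) :
    act q x (vT k y * t) = (q.toFun x y : k) • (vT k (x ◃ y) * act q x t) := by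
  have : act q x ∘ₗ LinearMap.mulLeft k (vT k y) =
      (q.toFun x y : k) • (LinearMap.mulLeft k (vT k (x ◃ y)) ∘ₗ act q x) :=
    tAlg_hom_ext fun l => by simp [← wd_cons, act_cons]
  exact LinearMap.congr_fun this t

theorem act_act (x y : X) : act q x ∘ₗ act q y = act q (x ◃ y) ∘ₗ act q x := by
  refine tAlg_hom_ext fun l => ?_
  induction l with
  | nil => simp [act_nil, ← wd_nil]
  | cons z l ih =>
    simp only [LinearMap.comp_apply] at ih ⊢
    simp only [act_cons, map_smul, act_mul, ih, smul_smul]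
    rw [Shelf.self_distrib (x := x) (y := y) (z := z)]
    congr 1
    have := q.cocycle' x y z
    linear_combination -this

theorem comulT_nil : comulT q (wd k []) = 1 ⊗ₜ 1 := wordLift_wd _ _

theorem comulT_cons (x : X) (l : List X) :
    comulT q (wd k (x :: l)) = comulStep q x (comulT q (wd k l)) := by
  rw [comulT, wordLift_wd, wordLift_wd]; rfl

theorem comulT_mul (x : X) (t : TAlg k X) :
    comulT q (vT k x * t) = comulStep q x (comulT q t) := by
  have : comulT q ∘ₗ LinearMap.mulLeft k (vT k x) = comulStep q x ∘ₗ comulT q :=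
    tAlg_hom_ext fun l => by simp [← wd_cons, comulT_cons]
  exact LinearMap.congr_fun this t

theorem comulStep_tmul (x : X) (s t : TAlg k X) :
    comulStep q x (s ⊗ₜ t) = (vT k x * s) ⊗ₜ t + act q x s ⊗ₜ (vT k x * t) := by
  simp [comulStep]

theorem act_comulStep (x y : X) (z : TAlg k X ⊗[k] TAlg k X) :
    TensorProduct.map (act q x) (act q x) (comulStep q y z) =
      (q.toFun x y : k) • comulStep q (x ◃ y) (TensorProduct.map (act q x) (act q x) z) := by
  induction z with
  | zero => simp
  | add z w hz hw => simp only [map_add, hz, hw, smul_add]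
  | tmul s t =>
    have := LinearMap.congr_fun (act_act q x y) s
    simp only [LinearMap.comp_apply] at this
    simp only [comulStep_tmul, map_add, TensorProduct.map_tmul, act_mul, this, smul_add,
      TensorProduct.smul_tmul', TensorProduct.tmul_smul]

theorem comulT_act (x : X) (t : TAlg k X) :
    comulT q (act q x t) = TensorProduct.map (act q x) (act q x) (comulT q t) := by
  have : comulT q ∘ₗ act q x = TensorProduct.map (act q x) (act q x) ∘ₗ comulT q := by
    refine tAlg_hom_ext fun l => ?_
    induction l with
    | nil =>
      simp only [LinearMap.comp_apply, act_nil, comulT_nil, TensorProduct.map_tmul]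
      rw [← wd_nil, act_nil, ← wd_nil, comulT_nil]; rfl
    | cons y l ih =>
      simp only [LinearMap.comp_apply] at ih ⊢
      rw [act_cons, map_smul, comulT_mul, ih, comulT_cons, act_comulStep]
  exact LinearMap.congr_fun this t

/-- Coassociativity. -/
theorem comulT_coassoc (t : TAlg k X) :
    TensorProduct.assoc k _ _ _ (TensorProduct.map (comulT q) LinearMap.id (comulT q t)) =
      TensorProduct.map LinearMap.id (comulT q) (comulT q t) := by
  let step3 : X → Module.End k (TAlg k X ⊗[k] (TAlg k X ⊗[k] TAlg k X)) := fun x =>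
    TensorProduct.map (LinearMap.mulLeft k (vT k x)) LinearMap.id +
      TensorProduct.map (act q x) (comulStep q x)
  have h1 : ∀ x z, TensorProduct.map LinearMap.id (comulT q) (comulStep q x z) =
      step3 x (TensorProduct.map LinearMap.id (comulT q) z) := by
    intro x z
    induction z with
    | zero => simp
    | add z w hz hw => simp only [map_add, hz, hw]
    | tmul s t => simp [step3, comulStep_tmul, comulT_mul]
  have h2 : ∀ x (z : TAlg k X ⊗[k] TAlg k X) (w : TAlg k X),
      TensorProduct.assoc k _ _ _ (comulStep q x z ⊗ₜ w) +
        TensorProduct.assoc k _ _ _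
          (TensorProduct.map (act q x) (act q x) z ⊗ₜ (vT k x * w)) =
        step3 x (TensorProduct.assoc k _ _ _ (z ⊗ₜ w)) := by
    intro x z w
    induction z with
    | zero => simp
    | add z z' hz hz' =>
      simp only [map_add, TensorProduct.add_tmul] at hz hz' ⊢
      rw [← hz, ← hz']; abel
    | tmul s t =>
      simp only [comulStep_tmul, TensorProduct.add_tmul, map_add, TensorProduct.assoc_tmul,
        TensorProduct.map_tmul, step3, LinearMap.add_apply, LinearMap.mulLeft_apply,
        LinearMap.id_apply, TensorProduct.tmul_add]
      abel
  have h3 : ∀ x z, TensorProduct.assoc k _ _ _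
      (TensorProduct.map (comulT q) LinearMap.id (comulStep q x z)) =
      step3 x (TensorProduct.assoc k _ _ _ (TensorProduct.map (comulT q) LinearMap.id z)) := by
    intro x z
    induction z with
    | zero => simp
    | add z w hz hw => simp only [map_add, hz, hw]
    | tmul s t =>
      simp only [comulStep_tmul, map_add, TensorProduct.map_tmul, comulT_mul, comulT_act,
        LinearMap.id_apply]
      exact h2 x _ _
  refine tAlg_induction (p := fun t => TensorProduct.assoc k _ _ _
      (TensorProduct.map (comulT q) LinearMap.id (comulT q t)) =
      TensorProduct.map LinearMap.id (comulT q) (comulT q t)) t (by simp) (fun l => ?_)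
    (fun s t hs ht => by simp only [map_add, hs, ht]) (fun a t ht => by simp only [map_smul, ht])
  induction l with
  | nil =>
    have h4 : comulT q (1 : TAlg k X) = 1 ⊗ₜ 1 := comulT_nil q
    simp [comulT_nil, h4]
  | cons x l ih => rw [comulT_cons, h3, h1, ih]

theorem projT_act (n : ℕ) (x : X) (t : TAlg k X) :
    projT n (act q x t) = act q x (projT n t) := by
  have : projT n ∘ₗ act q x = act q x ∘ₗ projT n := by
    refine tAlg_hom_ext fun l => ?_
    induction l generalizing n with
    | nil =>
      simp only [LinearMap.comp_apply, act_nil]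
      rw [← wd_nil, projT_wd]
      split_ifs
      · rw [act_nil, wd_nil]
      · simp
    | cons y l ih =>
      simp only [LinearMap.comp_apply] at ih ⊢
      rw [act_cons, map_smul]
      cases n with
      | zero => rw [projT_zero_mul, wd_cons, projT_zero_mul]; simp
      | succ n => rw [projT_succ_mul, ih, wd_cons, projT_succ_mul, act_mul]
  exact LinearMap.congr_fun this t

/-- The first degree component of the comultiplication: `Δ_{0,n}(t) = 1 ⊗ t`. -/
theorem projT_zero_comulT (l : List X) :
    TensorProduct.map (projT 0) LinearMap.id (comulT q (wd k l)) = 1 ⊗ₜ wd k l := by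
  induction l with
  | nil =>
    have : projT 0 (1 : TAlg k X) = 1 := by rw [← wd_nil, projT_wd]; simp
    rw [comulT_nil, TensorProduct.map_tmul, this, wd_nil]; rfl
  | cons x l ih =>
    have key : ∀ z : TAlg k X ⊗[k] TAlg k X,
        TensorProduct.map (projT 0) LinearMap.id (comulStep q x z) =
        TensorProduct.map (act q x) (LinearMap.mulLeft k (vT k x))
          (TensorProduct.map (projT 0) LinearMap.id z) := by
      intro z
      induction z with
      | zero => simp
      | add z w hz hw => simp only [map_add, hz, hw]
      | tmul s t => simp [comulStep_tmul, projT_zero_mul, projT_act]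
    rw [comulT_cons, key, ih, TensorProduct.map_tmul, ← wd_nil, act_nil]
    simp [wd_cons, wd_nil]

theorem map_comulStep (x : X) (F : Module.End k (TAlg k X)) (z : TAlg k X ⊗[k] TAlg k X) :
    TensorProduct.map (projT 1) F (comulStep q x z) =
      TensorProduct.map (LinearMap.mulLeft k (vT k x)) F
        (TensorProduct.map (projT 0) LinearMap.id z) +
      TensorProduct.map (act q x) (F ∘ₗ LinearMap.mulLeft k (vT k x))
        (TensorProduct.map (projT 1) LinearMap.id z) := by
  induction z with
  | zero => simp
  | add z w hz hw =>
    simp only [map_add, hz, hw]; abel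
  | tmul s t =>
    simp only [comulStep_tmul, map_add, TensorProduct.map_tmul, projT_act, LinearMap.id_apply,
      LinearMap.mulLeft_apply, LinearMap.comp_apply]
    rw [show projT 1 (vT k x * s) = vT k x * projT 0 s from projT_succ_mul 0 x s]

/-- The comultiplication is graded. -/
theorem comulT_graded (l : List X) (i : ℕ) :
    TensorProduct.map (projT 1) (projT i) (comulT q (wd k l)) =
      if l.length = i + 1 then TensorProduct.map (projT 1) LinearMap.id (comulT q (wd k l))
        else 0 := by
  induction l generalizing i with
  | nil =>
    have : projT 1 (1 : TAlg k X) = 0 := by rw [← wd_nil, projT_wd]; simp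
    simp [comulT_nil, this]
  | cons x l ih =>
    rw [comulT_cons, map_comulStep, map_comulStep, projT_zero_comulT]
    cases i with
    | zero =>
      have h0 : (projT 0 : Module.End k (TAlg k X)) ∘ₗ LinearMap.mulLeft k (vT k x) = 0 :=
        LinearMap.ext fun t => projT_zero_mul x t
      rw [h0]
      cases l with
      | nil =>
        have : projT 1 (1 : TAlg k X) = 0 := by rw [← wd_nil, projT_wd]; simp
        simp [comulT_nil, this, projT_wd]
      | cons y l => simp [projT_wd]
    | succ i =>
      have h1 : (projT (i + 1) : Module.End k (TAlg k X)) ∘ₗ LinearMap.mulLeft k (vT k x) =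
          LinearMap.mulLeft k (vT k x) ∘ₗ projT i := LinearMap.ext fun t => projT_succ_mul i x t
      have h2 : ∀ z : TAlg k X ⊗[k] TAlg k X,
          TensorProduct.map (act q x) (LinearMap.mulLeft k (vT k x) ∘ₗ projT i)
            (TensorProduct.map (projT 1) LinearMap.id z) =
          TensorProduct.map (act q x) (LinearMap.mulLeft k (vT k x))
            (TensorProduct.map (projT 1) (projT i) z) := by
        intro z
        induction z with
        | zero => simp
        | add z w hz hw => simp only [map_add, hz, hw]
        | tmul s t => simp
      rw [h1, h2, ih]
      by_cases h : l.length = i + 1 <;> simp [projT_wd, h]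

/-- The formula `Δ_{1,n-1} = 1 + c_1 + c_1 c_2 + ⋯ + c_1 ⋯ c_{n-1}`. -/
theorem comulT_one (x : X) (l : List X) :
    LinearMap.mul' k _ (TensorProduct.map (projT 1) LinearMap.id (comulT q (wd k (x :: l)))) =
      ∑ j ∈ Finset.range (l.length + 1), evalWord (braid q) (List.range j) (wd k (x :: l)) := by
  have key : ∀ (x : X) (z : TAlg k X ⊗[k] TAlg k X),
      LinearMap.mul' k _ (TensorProduct.map (act q x) (LinearMap.mulLeft k (vT k x))
        (TensorProduct.map (projT 1) LinearMap.id z)) =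
      braid q 0 (vT k x * LinearMap.mul' k _ (TensorProduct.map (projT 1) LinearMap.id z)) := by
    intro x
    refine tAlg_tensor_ext (f := LinearMap.mul' k _ ∘ₗ TensorProduct.map (act q x)
        (LinearMap.mulLeft k (vT k x)) ∘ₗ TensorProduct.map (projT 1) LinearMap.id)
      (g := braid q 0 ∘ₗ LinearMap.mulLeft k (vT k x) ∘ₗ LinearMap.mul' k _ ∘ₗ
        TensorProduct.map (projT 1) LinearMap.id) fun l l' => ?_
    simp only [LinearMap.comp_apply, TensorProduct.map_tmul, LinearMap.id_apply,
      LinearMap.mul'_apply, LinearMap.mulLeft_apply, projT_wd]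
    match l with
    | [] => simp
    | [y] =>
      simp only [List.length_singleton, if_true]
      rw [← wd_append, ← wd_cons, ← wd_cons, List.singleton_append, braid_zero_wd, act_cons,
        act_nil, mul_one, smul_mul_assoc, ← wd_cons]
    | y :: z :: l => simp
  induction l generalizing x with
  | nil =>
    have : projT 1 (1 : TAlg k X) = 0 := by rw [← wd_nil, projT_wd]; simp
    have h' : projT 1 (vT k x) = vT k x := by rw [vT, projT_wd]; simp
    have h0 : projT 1 (act q x (1 : TAlg k X)) = 0 := by rw [projT_act, this, map_zero]
    simp only [comulT_cons, comulT_nil, comulStep_tmul, map_add, TensorProduct.map_tmul, h0,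
      mul_one, LinearMap.id_apply, h']
    simp [vT, evalWord_nil]
  | cons y l ih =>
    rw [comulT_cons, map_comulStep, projT_zero_comulT, map_add, LinearMap.id_comp, key, ih,
      List.length_cons, Finset.sum_range_succ' _ (l.length + 1), add_comm, Finset.mul_sum, map_sum]
    congr 1
    · refine Finset.sum_congr rfl fun j _ => ?_
      rw [range_succ_eval, Module.End.mul_apply, wd_cons x (y :: l), evalWord_shift_mul]
    · simp [evalWord_nil, wd_cons]

/-- The symmetrizer is obtained from the first component of the comultiplication. -/
theorem totalSymmetrizer_comulT (x : X) (l : List X) :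
    totalSymmetrizer q (wd k (x :: l)) =
      LinearMap.mul' k _ (TensorProduct.map (projT 1) (totalSymmetrizer q)
        (comulT q (wd k (x :: l)))) := by
  have key : ∀ z : TAlg k X ⊗[k] TAlg k X,
      LinearMap.mul' k _ (TensorProduct.map (projT 1) (braidedSymmetrizer q l.length) z) =
      symSum (fun i => braid q (i + 1)) l.length
        (LinearMap.mul' k _ (TensorProduct.map (projT 1) LinearMap.id z)) := by
    refine tAlg_tensor_ext (f := LinearMap.mul' k _ ∘ₗ TensorProduct.map (projT 1)
        (braidedSymmetrizer q l.length))
      (g := symSum (fun i => braid q (i + 1)) l.length ∘ₗ LinearMap.mul' k _ ∘ₗ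
        TensorProduct.map (projT 1) LinearMap.id) fun l₁ l₂ => ?_
    simp only [LinearMap.comp_apply, TensorProduct.map_tmul, LinearMap.id_apply,
      LinearMap.mul'_apply, projT_wd]
    match l₁ with
    | [] => simp
    | [y] =>
      simp only [List.length_singleton, if_true]
      exact (symSum_shift_mul q _ y _).symm
    | y :: z :: l => simp
  have h1 : ∀ F : Module.End k (TAlg k X),
      TensorProduct.map (projT 1) F (comulT q (wd k (x :: l))) =
        TensorProduct.map (projT 1) (F ∘ₗ projT l.length) (comulT q (wd k (x :: l))) := by
    intro F
    have h := comulT_graded q (x :: l) l.length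
    rw [List.length_cons, if_pos rfl] at h
    have e1 : TensorProduct.map (projT 1) (F ∘ₗ projT l.length) =
        TensorProduct.map LinearMap.id F ∘ₗ
          TensorProduct.map (projT 1 : Module.End k (TAlg k X)) (projT l.length) := by
      rw [← TensorProduct.map_comp, LinearMap.id_comp]
    have e2 : TensorProduct.map (projT 1) F =
        TensorProduct.map LinearMap.id F ∘ₗ
          TensorProduct.map (projT 1 : Module.End k (TAlg k X)) LinearMap.id := by
      rw [← TensorProduct.map_comp, LinearMap.id_comp, LinearMap.comp_id]
    rw [e1, e2, LinearMap.comp_apply, LinearMap.comp_apply, h]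
  have h2 : totalSymmetrizer q ∘ₗ projT l.length =
      braidedSymmetrizer q l.length ∘ₗ projT l.length := by
    refine tAlg_hom_ext fun l' => ?_
    simp only [LinearMap.comp_apply, projT_wd]
    split_ifs with h
    · rw [totalSymmetrizer, glue_wd, h]
    · simp
  rw [h1, h2, ← h1, key, comulT_one, totalSymmetrizer, glue_wd, List.length_cons,
    braidedSymmetrizer_eq, symSum_succ (isBraidFamily_braid q), Module.End.mul_apply,
    LinearMap.sum_apply]

theorem totalSymmetrizer_nil : totalSymmetrizer q (wd k []) = 1 := by
  rw [totalSymmetrizer, glue_wd, List.length_nil, braidedSymmetrizer, Fintype.sum_unique]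
  have h := (reducedWord_spec 0 default).2 []
    ⟨by simp, fun j => j.elim0⟩
  rw [List.eq_nil_of_length_eq_zero (Nat.le_zero.1 h)]
  rfl

/-- The symmetrizers are compatible with the components of the comultiplication. -/
theorem split_totalSymmetrizer (i : ℕ) (t : TAlg k X) :
    wordLift (splitWord i) (totalSymmetrizer q t) =
      TensorProduct.map (totalSymmetrizer q ∘ₗ projT i) (totalSymmetrizer q) (comulT q t) := by
  have main : wordLift (splitWord i) ∘ₗ totalSymmetrizer q =
      TensorProduct.map (totalSymmetrizer q ∘ₗ projT i) (totalSymmetrizer q) ∘ₗ comulT q := by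
    clear t
    induction i with
    | zero =>
      have h1 : ∀ t : TAlg k X, wordLift (splitWord 0) t = (1 : TAlg k X) ⊗ₜ[k] t := by
        intro t
        have : wordLift (splitWord 0) = TensorProduct.mk k (TAlg k X) (TAlg k X) 1 :=
          tAlg_hom_ext fun l => by rw [wordLift_wd]; rfl
        rw [this]; rfl
      refine tAlg_hom_ext fun l => ?_
      have e1 : TensorProduct.map (totalSymmetrizer q ∘ₗ projT 0) (totalSymmetrizer q) =
          TensorProduct.map (totalSymmetrizer q) (totalSymmetrizer q) ∘ₗ
            TensorProduct.map (projT 0) LinearMap.id := by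
        rw [← TensorProduct.map_comp, LinearMap.comp_id]
      rw [LinearMap.comp_apply, LinearMap.comp_apply, h1, e1, LinearMap.comp_apply,
        projT_zero_comulT, TensorProduct.map_tmul, ← wd_nil, totalSymmetrizer_nil, wd_nil]
    | succ i ih =>
      have hp : projT (i + 1) (1 : TAlg k X) = 0 := by rw [← wd_nil, projT_wd]; simp
      have hp1 : projT 1 (1 : TAlg k X) = 0 := by rw [← wd_nil, projT_wd]; simp
      -- the lower components
      have hG : LinearMap.mul' k (TAlg k X) ∘ₗ
          TensorProduct.map (projT 1) (totalSymmetrizer q ∘ₗ projT i) ∘ₗ comulT q =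
          totalSymmetrizer q ∘ₗ projT (i + 1) := by
        refine tAlg_hom_ext fun l => ?_
        cases l with
        | nil =>
          rw [LinearMap.comp_apply, LinearMap.comp_apply, comulT_nil, TensorProduct.map_tmul, hp1,
            LinearMap.comp_apply (totalSymmetrizer q) (projT (i + 1)), wd_nil, hp,
            TensorProduct.zero_tmul, map_zero, map_zero]
        | cons x l =>
          have e1 : TensorProduct.map (projT 1) (totalSymmetrizer q ∘ₗ projT i) =
              TensorProduct.map LinearMap.id (totalSymmetrizer q) ∘ₗ
                TensorProduct.map (projT 1 : Module.End k (TAlg k X)) (projT i) := by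
            rw [← TensorProduct.map_comp, LinearMap.id_comp]
          have e2 : TensorProduct.map (projT 1) (totalSymmetrizer q) =
              TensorProduct.map LinearMap.id (totalSymmetrizer q) ∘ₗ
                TensorProduct.map (projT 1 : Module.End k (TAlg k X)) LinearMap.id := by
            rw [← TensorProduct.map_comp, LinearMap.id_comp, LinearMap.comp_id]
          have h3 := totalSymmetrizer_comulT q x l
          rw [e2, LinearMap.comp_apply] at h3
          rw [LinearMap.comp_apply, LinearMap.comp_apply, e1, LinearMap.comp_apply,
            comulT_graded, LinearMap.comp_apply, projT_wd]
          split_ifs with h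
          · exact h3.symm
          · simp
      refine tAlg_hom_ext fun l => ?_
      cases l with
      | nil =>
        rw [LinearMap.comp_apply, LinearMap.comp_apply, totalSymmetrizer_nil, comulT_nil,
          TensorProduct.map_tmul, LinearMap.comp_apply, hp, ← wd_nil, wordLift_wd]
        simp [splitWord]
      | cons x l =>
        rw [LinearMap.comp_apply, LinearMap.comp_apply, totalSymmetrizer_comulT, splitWord_mulT, ih]
        have e1 : TensorProduct.map (projT 1 : Module.End k (TAlg k X))
            (TensorProduct.map (totalSymmetrizer q ∘ₗ projT i) (totalSymmetrizer q) ∘ₗ comulT q) =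
            TensorProduct.map (projT 1 : Module.End k (TAlg k X))
              (TensorProduct.map (totalSymmetrizer q ∘ₗ projT i) (totalSymmetrizer q)) ∘ₗ
            TensorProduct.map LinearMap.id (comulT q) := by
          rw [← TensorProduct.map_comp, LinearMap.comp_id]
        rw [e1, LinearMap.comp_apply, ← comulT_coassoc, mulFirst_assoc, ← hG]
        have e2 : TensorProduct.map (LinearMap.mul' k (TAlg k X) ∘ₗ
            TensorProduct.map (projT 1) (totalSymmetrizer q ∘ₗ projT i) ∘ₗ comulT q)
              (totalSymmetrizer q) =
            TensorProduct.map (LinearMap.mul' k (TAlg k X) ∘ₗ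
              TensorProduct.map (projT 1) (totalSymmetrizer q ∘ₗ projT i)) (totalSymmetrizer q) ∘ₗ
            TensorProduct.map (comulT q) LinearMap.id := by
          rw [← TensorProduct.map_comp, LinearMap.comp_id, LinearMap.comp_assoc]
        rw [e2, LinearMap.comp_apply]
  exact LinearMap.congr_fun main t

theorem totalSymmetrizer_map_comulT (t : TAlg k X) (ht : totalSymmetrizer q t = 0) :
    TensorProduct.map (totalSymmetrizer q) (totalSymmetrizer q) (comulT q t) = 0 := by
  obtain ⟨N, hN⟩ := exists_projT_sum (comulT q t)
  have hsum : totalSymmetrizer q ∘ₗ (∑ i ∈ Finset.range N, projT i) =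
      ∑ i ∈ Finset.range N, totalSymmetrizer q ∘ₗ projT i :=
    LinearMap.ext fun t => by
      simp only [LinearMap.comp_apply, LinearMap.sum_apply, map_sum]
  rw [← hN N le_rfl, ← LinearMap.comp_apply, ← TensorProduct.map_comp, LinearMap.comp_id,
    hsum, ← TensorProduct.mapBilinear_apply, map_sum, LinearMap.sum_apply, LinearMap.sum_apply]
  refine Finset.sum_eq_zero fun i _ => ?_
  rw [TensorProduct.mapBilinear_apply, ← split_totalSymmetrizer, ht, map_zero]

/-- `∑ ker S_n` is a coideal. -/
theorem toNichols_map_comulT (t : TAlg k X) (ht : totalSymmetrizer q t = 0) :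
    TensorProduct.map (toNichols q).toLinearMap (toNichols q).toLinearMap (comulT q t) = 0 := by
  have h := totalSymmetrizer_map_comulT q t ht
  rw [← nicholsEmb_comp, TensorProduct.map_comp, LinearMap.comp_apply] at h
  have hinj : Function.Injective (TensorProduct.map (nicholsEmb q) (nicholsEmb q)) :=
    TensorProduct.map_injective_of_flat_flat _ _ (nicholsEmb_injective q) (nicholsEmb_injective q)
  exact hinj (h.trans (map_zero _).symm)

/-- The comultiplication `Δ : 𝓑(V) → 𝓑(V) ⊗ 𝓑(V)`, induced by the comultiplication of `T(V)`. -/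
noncomputable def comul : NicholsAlgebra q →ₗ[k] NicholsAlgebra q ⊗[k] NicholsAlgebra q :=
  nicholsLift q
    (TensorProduct.map (toNichols q).toLinearMap (toNichols q).toLinearMap ∘ₗ comulT q)
    (toNichols_map_comulT q)

/-! ### The coaction of the enveloping group -/

/-- The degree of a word in the enveloping group `G_X`. -/
def wordDegree (l : List X) : Rack.EnvelGroup X :=
  (l.map fun x => (Rack.toEnvelGroup X x : Rack.EnvelGroup X)).prod

/-- The coaction `δ(t) = g ⊗ t` for `t ∈ T(V)` of degree `g ∈ G_X`. -/
noncomputable def coactionT :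
    TAlg k X →ₗ[k] MonoidAlgebra k (Rack.EnvelGroup X) ⊗[k] TAlg k X :=
  wordLift fun l => MonoidAlgebra.single (wordDegree l) 1 ⊗ₜ wd k l

theorem coactionT_wd (l : List X) :
    coactionT (wd k l) = MonoidAlgebra.single (wordDegree l) (1 : k) ⊗ₜ wd k l := wordLift_wd _ _

theorem wordDegree_cons (x : X) (l : List X) :
    wordDegree (x :: l) = (Rack.toEnvelGroup X x : Rack.EnvelGroup X) * wordDegree l := by
  simp [wordDegree]

theorem toEnvelGroup_act (x y : X) :
    (Rack.toEnvelGroup X (x ◃ y) : Rack.EnvelGroup X) * (Rack.toEnvelGroup X x : Rack.EnvelGroup X) =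
      (Rack.toEnvelGroup X x : Rack.EnvelGroup X) * (Rack.toEnvelGroup X y : Rack.EnvelGroup X) := by
  have h : (Rack.toEnvelGroup X (x ◃ y) : Rack.EnvelGroup X) =
      (Rack.toEnvelGroup X x : Rack.EnvelGroup X) * (Rack.toEnvelGroup X y : Rack.EnvelGroup X) *
        (Rack.toEnvelGroup X x : Rack.EnvelGroup X)⁻¹ :=
    (Rack.toEnvelGroup X).map_act' (x := x) (y := y)
  rw [h, inv_mul_cancel_right]

theorem coactionT_mul (x : X) (t : TAlg k X) :
    coactionT (vT k x * t) = TensorProduct.map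
      (LinearMap.mulLeft k (MonoidAlgebra.single (Rack.toEnvelGroup X x : Rack.EnvelGroup X) (1 : k)))
      (LinearMap.mulLeft k (vT k x)) (coactionT t) := by
  have : coactionT ∘ₗ LinearMap.mulLeft k (vT k x) = TensorProduct.map
      (LinearMap.mulLeft k (MonoidAlgebra.single (Rack.toEnvelGroup X x : Rack.EnvelGroup X) (1 : k)))
      (LinearMap.mulLeft k (vT k x)) ∘ₗ coactionT := tAlg_hom_ext fun l => by
    simp only [LinearMap.comp_apply, LinearMap.mulLeft_apply, ← wd_cons, coactionT_wd,
      TensorProduct.map_tmul, MonoidAlgebra.single_mul_single, mul_one, wordDegree_cons]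
  exact LinearMap.congr_fun this t

theorem coactionT_braid (i : ℕ) (t : TAlg k X) :
    coactionT (braid q i t) = TensorProduct.map LinearMap.id (braid q i) (coactionT t) := by
  have : coactionT ∘ₗ braid q i = TensorProduct.map LinearMap.id (braid q i) ∘ₗ coactionT := by
    refine tAlg_hom_ext fun l => ?_
    simp only [LinearMap.comp_apply]
    induction i generalizing l with
    | zero =>
      match l with
      | [] => simp [braid_nil, coactionT_wd]
      | [x] => simp [braid_zero_single, coactionT_wd]
      | x :: y :: l =>
        rw [braid_zero_wd, map_smul, coactionT_wd, coactionT_wd, TensorProduct.map_tmul,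
          braid_zero_wd, TensorProduct.tmul_smul, wordDegree_cons, wordDegree_cons,
          wordDegree_cons, wordDegree_cons, ← mul_assoc, toEnvelGroup_act, mul_assoc]
        rfl
    | succ i ih =>
      match l with
      | [] => simp [braid_nil, coactionT_wd]
      | x :: l =>
        rw [braid_succ_wd, coactionT_mul, ih, coactionT_wd, coactionT_wd, TensorProduct.map_tmul,
          TensorProduct.map_tmul, TensorProduct.map_tmul, braid_succ_wd, wordDegree_cons]
        simp [MonoidAlgebra.single_mul_single]
  exact LinearMap.congr_fun this t

theorem coactionT_totalSymmetrizer (t : TAlg k X) :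
    coactionT (totalSymmetrizer q t) =
      TensorProduct.map LinearMap.id (totalSymmetrizer q) (coactionT t) := by
  have hL : ∀ (L : List ℕ) (t : TAlg k X), coactionT (evalWord (braid q) L t) =
      TensorProduct.map LinearMap.id (evalWord (braid q) L) (coactionT t) := by
    intro L t
    induction L with
    | nil =>
      rw [evalWord_nil]
      change _ = TensorProduct.map LinearMap.id LinearMap.id _
      rw [TensorProduct.map_id]; rfl
    | cons i L ih =>
      rw [evalWord_cons, Module.End.mul_apply, coactionT_braid, ih, ← LinearMap.comp_apply,
        ← TensorProduct.map_comp]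
      rfl
  have : coactionT ∘ₗ totalSymmetrizer q =
      TensorProduct.map LinearMap.id (totalSymmetrizer q) ∘ₗ coactionT := by
    refine tAlg_hom_ext fun l => ?_
    simp only [LinearMap.comp_apply]
    rw [totalSymmetrizer, glue_wd, coactionT_wd, TensorProduct.map_tmul, glue_wd,
      braidedSymmetrizer, LinearMap.sum_apply, map_sum, TensorProduct.tmul_sum]
    refine Finset.sum_congr rfl fun s _ => ?_
    rw [hL, coactionT_wd, TensorProduct.map_tmul]
  exact LinearMap.congr_fun this t

theorem toNichols_map_coactionT (t : TAlg k X) (ht : totalSymmetrizer q t = 0) :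
    TensorProduct.map LinearMap.id (toNichols q).toLinearMap (coactionT t) = 0 := by
  have h := coactionT_totalSymmetrizer q t
  rw [ht, map_zero, ← nicholsEmb_comp,
    ← LinearMap.comp_id (LinearMap.id : MonoidAlgebra k (Rack.EnvelGroup X) →ₗ[k] _),
    TensorProduct.map_comp, LinearMap.comp_apply] at h
  have hinj : Function.Injective (TensorProduct.map
      (LinearMap.id : MonoidAlgebra k (Rack.EnvelGroup X) →ₗ[k] _) (nicholsEmb q)) :=
    TensorProduct.map_injective_of_flat_flat _ _ Function.injective_id (nicholsEmb_injective q)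
  exact hinj (h.symm.trans (map_zero _).symm)

/-- The coaction `𝓑(V) → k[G_X] ⊗ 𝓑(V)`, for which the class of a word `x₁ ⋯ xₙ` is homogeneous of
degree `g_{x₁} ⋯ g_{xₙ}`. -/
noncomputable def coaction :
    NicholsAlgebra q →ₗ[k] MonoidAlgebra k (Rack.EnvelGroup X) ⊗[k] NicholsAlgebra q :=
  nicholsLift q (TensorProduct.map LinearMap.id (toNichols q).toLinearMap ∘ₗ coactionT)
    (toNichols_map_coactionT q)

/-! ### Left coideal subalgebras -/

/-- The homogeneous component `𝓑(V)(n)`. -/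
noncomputable def degreePart (n : ℕ) : Submodule k (NicholsAlgebra q) :=
  (tensorPower k X n).map (toNichols q).toLinearMap

/-- `C` is a left coideal: `Δ(C) ⊆ 𝓑(V) ⊗ C`. -/
def IsLeftCoideal (C : Submodule k (NicholsAlgebra q)) : Prop :=
  ∀ x ∈ C, comul q x ∈ LinearMap.range (TensorProduct.map
    (LinearMap.id : NicholsAlgebra q →ₗ[k] NicholsAlgebra q) C.subtype)

/-- `C` is a `k[G_X]`-subcomodule: `δ(C) ⊆ k[G_X] ⊗ C`. -/
def IsSubcomodule (C : Submodule k (NicholsAlgebra q)) : Prop :=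
  ∀ x ∈ C, coaction q x ∈ LinearMap.range (TensorProduct.map
    (LinearMap.id : MonoidAlgebra k (Rack.EnvelGroup X) →ₗ[k] _) C.subtype)

/-- `C` is an `ℕ₀`-graded subspace: it is the sum of its homogeneous components
`C(n) = C ∩ 𝓑(V)(n)`. -/
def IsGradedSubspace (C : Submodule k (NicholsAlgebra q)) : Prop :=
  C = ⨆ n, C ⊓ degreePart q n

/-- `C` is a left coideal subalgebra in the category of `ℕ₀`-graded `k[G_X]`-comodules. -/
structure IsGradedLeftCoidealSubalgebra (C : Subalgebra k (NicholsAlgebra q)) : Prop where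
  graded : IsGradedSubspace q (Subalgebra.toSubmodule C)
  subcomodule : IsSubcomodule q (Subalgebra.toSubmodule C)
  leftCoideal : IsLeftCoideal q (Subalgebra.toSubmodule C)

/-- `C` is generated in degree one: `C = ⟨C(1)⟩`. -/
def IsGeneratedInDegreeOne (C : Subalgebra k (NicholsAlgebra q)) : Prop :=
  C = Algebra.adjoin k ((C : Set (NicholsAlgebra q)) ∩ degreePart q 1)

/-- The basis vector `v_x`, as an element of `𝓑(V)`. -/
noncomputable def v (x : X) : NicholsAlgebra q := toNichols q (vT k x)

/-- `𝓑(V)` is slim in degree two. -/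
def IsSlimInDegreeTwo : Prop :=
  (∀ a b : X, a ◃ b = b → b ≠ a →
    toNichols q ((1 - braid q 0 : Module.End k (TAlg k X)) (vT k a * vT k b)) = 0) ∧
  (∀ a b : X, a ◃ b ≠ b →
    toNichols q ((1 - braid q 0 + braid q 0 ^ 2 : Module.End k (TAlg k X)) (vT k a * vT k b)) = 0)

/-- A rack is braided if it is a quandle and `x ▷ y = y` or `x ▷ (y ▷ x) = y` for all `x, y`. -/
def IsBraidedRack (X : Type*) [Rack X] : Prop :=
  (∀ x : X, x ◃ x = x) ∧ ∀ x y : X, x ◃ y = y ∨ x ◃ (y ◃ x) = y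

end RackNichols

open scoped Quandles TensorProduct
open RackNichols

namespace RackNichols

open scoped Quandles TensorProduct

/-! ### Braided racks -/

section BraidedRack

variable {X : Type*} [Rack X]

/-! Put p = b ◃ a and r = c ◃ b. Since X is braided and a, b do not commute, b ◃ a = p, a ◃ p = b
and p ◃ b = a. The rack automorphism c ◃ · carries a, b, p to e, r, d, so r ◃ e = d, e ◃ d = r and d
◃ r = e. The map c₁c₂ moves the last of three letters to the front, hence Z = v_c v_b v_a − α v_d
v_c v_b + αβ v_e v_d v_c with α = q_{b,a} q_{c,p} and β = q_{c,b} q_{d,r}.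

Left coideal subalgebra. C is spanned by monomials in homogeneous generators, which settles grading
and coaction. By induction on monomials, the coideal property reduces to showing that left
multiplication by Δ of each generator preserves 𝓑(V) ⊗ C. For a generator v_x this is clear from
Δ(v_x)(s ⊗ u) = v_x s ⊗ u + g_x·s ⊗ v_x u. For Z (`cubic_step_mem`), only the terms with v_c in the
right factor are in question. The terms in v_c v_b u and in v_d v_c u cancel by the choice of α and
β. The left factors at v_c u add up to a multiple of the quadratic relation for the pair (r, e),
hence to 0. The terms in v_c v_a u and v_e v_c u combine to N u with N = v_c v_a − q_{c,a} v_e v_c.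
This N is 0 if c and a commute, and otherwise slimness makes it a multiple of v_a v_e; so N lies in
C. The cubic terms share the left factor g_c g_b g_a·s and give Z u. The scalars match by the
cocycle identity q_{r,e} q_{c,a} = q_{c,p} q_{b,a} and by q_{r,e} q_{d,r} q_{e,d} = −1
(`IsSlimInDegreeTwo.cocycle_cube`).

Not generated in degree one. The symmetrizers embed 𝓑(V) into T(V), so the coefficient of the word
cba after symmetrizing is a linear functional on 𝓑(V). It vanishes on ⟨S⟩, because no word in the
letters a, b, d, e has cba in its symmetrization, and it equals 1 on Z (`cubic_notMem_adjoin`). The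
disjunctive hypothesis excludes the one remaining coincidence, e = b and d = a, in which v_e v_d v_c
could contribute to cba. Finally C(1) lies in the span of S for degree reasons
(`adjoin_union_inf_degreePart_one_le`), so generation in degree one would put Z into ⟨S⟩. -/

/-- Otherwise braidedness gives y ◃ (x ◃ y) = x, which collapses to y ◃ y = x, so that x = y. -/
theorem IsBraidedRack.comm_symm (hX : IsBraidedRack X) {x y : X} (h : x ◃ y = y) : y ◃ x = x := by
  rcases hX.2 y x with h' | h'
  · exact h'
  · rw [h, hX.1] at h'
    rw [← h', hX.1]

theorem IsBraidedRack.act_act_self (hX : IsBraidedRack X) {x y : X} (h : x ◃ y ≠ y) :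
    x ◃ (y ◃ x) = y := (hX.2 x y).resolve_left h

theorem IsBraidedRack.act_self_act (hX : IsBraidedRack X) {x y : X} (h : x ◃ y ≠ y) :
    (x ◃ y) ◃ x = y := by
  have h1 := Shelf.self_distrib (x := x) (y := y) (z := x)
  rw [hX.1, hX.act_act_self h] at h1
  exact h1.symm

theorem act_left_cancel {x y z : X} (h : x ◃ y = x ◃ z) : y = z := (Rack.left_cancel x).1 h

theorem IsBraidedRack.act_ne_left (hX : IsBraidedRack X) {x y : X} (h : x ≠ y) : x ◃ y ≠ x :=
  fun h' => h (act_left_cancel ((hX.1 x).trans h'.symm))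

end BraidedRack

variable {k : Type*} [Field k] {X : Type*} [Rack X] (q : TwoCocycle k X)

/-! ### The symmetrizers in low degrees -/

theorem symSum_zero {A : Type*} [Semiring A] (f : ℕ → A) : symSum f 0 = 1 := by
  have h := (reducedWord_spec 0 default).2 [] ⟨by simp, fun j => j.elim0⟩
  rw [symSum, Fintype.sum_unique, List.eq_nil_of_length_eq_zero (Nat.le_zero.1 h)]
  rfl

theorem symSum_two {A : Type*} [Semiring A] {f : ℕ → A} (hf : IsBraidFamily f) :
    symSum f 2 = 1 + f 0 := by
  rw [symSum_succ hf, symSum_succ hf.shift, symSum_zero]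
  simp [Finset.sum_range_succ, evalWord]

/-- The factors 1, f 0, f 0 * f 1 are coset representatives for the subgroup of order two generated
by the second transposition. -/
theorem symSum_three {A : Type*} [Semiring A] {f : ℕ → A} (hf : IsBraidFamily f) :
    symSum f 3 = (1 + f 1) * (1 + f 0 + f 0 * f 1) := by
  rw [symSum_succ hf, symSum_two hf.shift]
  simp [Finset.sum_range_succ, evalWord, List.range_succ]

theorem totalSymmetrizer_wd_two (x y : X) :
    totalSymmetrizer q (wd k [x, y]) = wd k [x, y] + (q.toFun x y : k) • wd k [x ◃ y, x] := by
  rw [totalSymmetrizer, glue_wd, List.length_cons, List.length_singleton, braidedSymmetrizer_eq,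
    symSum_two (isBraidFamily_braid q), LinearMap.add_apply, braid_zero_wd]
  rfl

/-- These are the six words, with their scalars, on which the whole proof that Z is not in ⟨S⟩
rests. -/
theorem totalSymmetrizer_wd_three (x y z : X) :
    totalSymmetrizer q (wd k [x, y, z]) =
      wd k [x, y, z] + (q.toFun y z : k) • wd k [x, y ◃ z, y] +
      (q.toFun x y : k) • (wd k [x ◃ y, x, z] + (q.toFun x z : k) • wd k [x ◃ y, x ◃ z, x]) +
      ((q.toFun y z : k) * (q.toFun x (y ◃ z) : k)) • (wd k [x ◃ (y ◃ z), x, y] +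
        (q.toFun x y : k) • wd k [x ◃ (y ◃ z), x ◃ y, x]) := by
  have h1 : ∀ x y z : X, braid q 1 (wd k [x, y, z]) = (q.toFun y z : k) • wd k [x, y ◃ z, y] :=
    fun x y z => by rw [braid_succ_wd, braid_zero_wd, mul_smul_comm, ← wd_cons]
  rw [totalSymmetrizer, glue_wd]
  change symSum (braid q) 3 _ = _
  rw [symSum_three (isBraidFamily_braid q)]
  simp only [Module.End.mul_apply, LinearMap.add_apply, Module.End.one_apply, map_add, map_smul,
    h1, braid_zero_wd]
  module

theorem totalSymmetrizer_mem {n : ℕ} {t : TAlg k X} (ht : t ∈ tensorPower k X n) :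
    totalSymmetrizer q t ∈ tensorPower k X n := by
  rw [totalSymmetrizer, glue_of_mem _ ht]
  exact braidedSymmetrizer_mem q n ht

/-! ### The action of the enveloping group on the Nichols algebra -/

/-- Self-distributivity matches the letters and the cocycle condition matches the scalars. This is
why the action of g_x passes to the quotient by the kernels of the symmetrizers. -/
theorem act_braid (x : X) (i : ℕ) (t : TAlg k X) :
    act q x (braid q i t) = braid q i (act q x t) := by
  have h0 : ∀ (y z : X) (t : TAlg k X), braid q 0 (vT k y * (vT k z * t)) =
      (q.toFun y z : k) • (vT k (y ◃ z) * (vT k y * t)) := by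
    intro y z t
    have : braid q 0 ∘ₗ LinearMap.mulLeft k (vT k y) ∘ₗ LinearMap.mulLeft k (vT k z) =
        (q.toFun y z : k) •
          (LinearMap.mulLeft k (vT k (y ◃ z)) ∘ₗ LinearMap.mulLeft k (vT k y)) :=
      tAlg_hom_ext fun l => by simp [← wd_cons, braid_zero_wd]
    exact LinearMap.congr_fun this t
  have : act q x ∘ₗ braid q i = braid q i ∘ₗ act q x := by
    refine tAlg_hom_ext fun l => ?_
    simp only [LinearMap.comp_apply]
    induction i generalizing l with
    | zero =>
      match l with
      | [] => rw [braid_nil, map_zero, act_nil, ← wd_nil, braid_nil]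
      | [y] =>
        rw [braid_zero_single, map_zero, act_cons, act_nil, mul_one, map_smul, vT,
          braid_zero_single, smul_zero]
      | y :: z :: l =>
        simp only [wd_cons, map_smul, act_mul, h0, mul_smul_comm, smul_smul]
        rw [Shelf.self_distrib (x := x) (y := y) (z := z)]
        congr 1
        linear_combination -(q.toFun x y : k) * q.cocycle' x y z
    | succ i ih =>
      match l with
      | [] => rw [braid_nil, map_zero, act_nil, ← wd_nil, braid_nil]
      | y :: l => simp only [wd_cons, braid_succ_mul, act_mul, map_smul, ih]
  exact LinearMap.congr_fun this t

theorem act_mem (x : X) (l : List X) : act q x (wd k l) ∈ tensorPower k X l.length := by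
  induction l with
  | nil => rw [act_nil]; exact wd_mem (k := k) []
  | cons y l ih => rw [act_cons]; exact Submodule.smul_mem _ _ (vT_mul_mem _ ih)

theorem totalSymmetrizer_act (x : X) (t : TAlg k X) :
    totalSymmetrizer q (act q x t) = act q x (totalSymmetrizer q t) := by
  have hL : ∀ (L : List ℕ) (t : TAlg k X), evalWord (braid q) L (act q x t) =
      act q x (evalWord (braid q) L t) := by
    intro L t
    induction L with
    | nil => rfl
    | cons i L ih => rw [evalWord_cons, Module.End.mul_apply, ih, ← act_braid]; rfl
  have : totalSymmetrizer q ∘ₗ act q x = act q x ∘ₗ totalSymmetrizer q :=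
    tAlg_hom_ext fun l => by
      rw [LinearMap.comp_apply, LinearMap.comp_apply, totalSymmetrizer, glue_of_mem _ (act_mem q x l),
        glue_wd]
      simp only [braidedSymmetrizer, LinearMap.sum_apply, hL, map_sum]
  exact LinearMap.congr_fun this t

/-- The action of the generator `g_x` of the enveloping group on `𝓑(V)`. -/
noncomputable def nicholsAct (x : X) : Module.End k (NicholsAlgebra q) :=
  nicholsLift q ((toNichols q).toLinearMap ∘ₗ act q x) fun t ht => by
    rw [LinearMap.comp_apply, AlgHom.toLinearMap_apply, toNichols_eq_zero, totalSymmetrizer_act, ht,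
      map_zero]

theorem nicholsAct_toNichols (x : X) (t : TAlg k X) :
    nicholsAct q x (toNichols q t) = toNichols q (act q x t) := rfl

theorem toNichols_surjective : Function.Surjective (toNichols q) := Ideal.Quotient.mk_surjective

theorem nicholsAct_mul (x y : X) (s : NicholsAlgebra q) :
    nicholsAct q x (v q y * s) = (q.toFun x y : k) • (v q (x ◃ y) * nicholsAct q x s) := by
  obtain ⟨t, rfl⟩ := toNichols_surjective q s
  rw [v, ← map_mul, nicholsAct_toNichols, act_mul, map_smul, map_mul, nicholsAct_toNichols]
  rfl

theorem nicholsAct_nicholsAct (x y : X) (s : NicholsAlgebra q) :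
    nicholsAct q (x ◃ y) (nicholsAct q x s) = nicholsAct q x (nicholsAct q y s) := by
  obtain ⟨t, rfl⟩ := toNichols_surjective q s
  simp only [nicholsAct_toNichols]
  exact congrArg _ (LinearMap.congr_fun (act_act q x y) t).symm

/-- Multiplication from the left by `Δ(v_x) = v_x ⊗ 1 + 1 ⊗ v_x` in the braided tensor product
algebra `𝓑(V) ⊗ 𝓑(V)`. -/
noncomputable def nicholsStep (x : X) :
    Module.End k (NicholsAlgebra q ⊗[k] NicholsAlgebra q) :=
  TensorProduct.map (LinearMap.mulLeft k (v q x)) LinearMap.id +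
    TensorProduct.map (nicholsAct q x) (LinearMap.mulLeft k (v q x))

theorem nicholsStep_tmul (x : X) (s t : NicholsAlgebra q) :
    nicholsStep q x (s ⊗ₜ t) = (v q x * s) ⊗ₜ t + nicholsAct q x s ⊗ₜ (v q x * t) := by
  simp [nicholsStep]

theorem comul_toNichols (t : TAlg k X) : comul q (toNichols q t) =
    TensorProduct.map (toNichols q).toLinearMap (toNichols q).toLinearMap (comulT q t) := rfl

/-- The only instance of multiplicativity of Δ that is needed: every generator of C is a polynomial
in the v_x, so Δ of a product is computed by composing these operators. -/
theorem comul_v_mul (x : X) (y : NicholsAlgebra q) :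
    comul q (v q x * y) = nicholsStep q x (comul q y) := by
  obtain ⟨t, rfl⟩ := toNichols_surjective q y
  rw [v, ← map_mul, comul_toNichols, comul_toNichols, comulT_mul]
  induction comulT q t with
  | zero => simp
  | add z w hz hw => simp only [map_add, hz, hw]
  | tmul s t =>
    simp only [comulStep_tmul, map_add, TensorProduct.map_tmul, nicholsStep_tmul,
      AlgHom.toLinearMap_apply, map_mul, nicholsAct_toNichols]
    rfl

end RackNichols

namespace RackNichols

open scoped Quandles TensorProduct

variable {k : Type*} [Field k] {X : Type*}

/-! ### Coefficients of words -/

open scoped Classical in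
/-- The coefficient of a word in an element of `T(V)`. -/
noncomputable def wordCoeff (l : List X) : TAlg k X →ₗ[k] k :=
  wordLift fun l' => if l' = l then 1 else 0

theorem wordCoeff_self (l : List X) : wordCoeff l (wd k l) = 1 := by
  rw [wordCoeff, wordLift_wd, if_pos rfl]

theorem wordCoeff_of_ne {l l' : List X} (h : l' ≠ l) : wordCoeff l (wd k l') = 0 := by
  rw [wordCoeff, wordLift_wd, if_neg h]

theorem wordCoeff_of_mem {l : List X} {n : ℕ} (h : l.length ≠ n) {t : TAlg k X}
    (ht : t ∈ tensorPower k X n) : wordCoeff l t = 0 := by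
  have : tensorPower k X n ≤ LinearMap.ker (wordCoeff (k := k) l) := by
    refine Submodule.span_le.2 ?_
    rintro _ ⟨l', rfl, rfl⟩
    exact wordCoeff_of_ne fun h' => h (h' ▸ rfl)
  exact this ht

/-! ### The relations in degree two -/

variable [Rack X] (q : TwoCocycle k X)

theorem toNichols_wd_two (x y : X) : toNichols q (wd k [x, y]) = v q x * v q y := by
  rw [wd_cons, map_mul]
  rfl

theorem toNichols_wd_three (x y z : X) :
    toNichols q (wd k [x, y, z]) = v q x * v q y * v q z := by
  rw [wd_cons, map_mul, toNichols_wd_two, ← mul_assoc]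
  rfl

variable {q}

theorem IsSlimInDegreeTwo.mul_comm_smul (hq : IsSlimInDegreeTwo q) {x y : X} (h : x ◃ y = y)
    (hxy : y ≠ x) : v q x * v q y = (q.toFun x y : k) • (v q y * v q x) := by
  have h1 := hq.1 x y h hxy
  rw [vT, vT, ← wd_append, List.singleton_append, LinearMap.sub_apply, braid_zero_wd, h,
    Module.End.one_apply, map_sub, map_smul, toNichols_wd_two, toNichols_wd_two] at h1
  exact sub_eq_zero.1 h1

/-- For a non-commuting pair, c_q permutes (x, y), (x ◃ y, x), (y, x ◃ y) cyclically up to scalars,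
because (x ◃ y) ◃ x = y. -/
theorem braid_relation (hX : IsBraidedRack X) {x y : X} (h : x ◃ y ≠ y) :
    (1 - braid q 0 + braid q 0 ^ 2 : Module.End k (TAlg k X)) (vT k x * vT k y) =
      wd k [x, y] - (q.toFun x y : k) • wd k [x ◃ y, x] +
        ((q.toFun x y : k) * (q.toFun (x ◃ y) x : k)) • wd k [y, x ◃ y] := by
  rw [vT, vT, ← wd_append, List.singleton_append, LinearMap.add_apply, LinearMap.sub_apply, pow_two,
    Module.End.mul_apply, Module.End.one_apply, braid_zero_wd, map_smul, braid_zero_wd, smul_smul,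
    hX.act_self_act h]

theorem IsSlimInDegreeTwo.relation (hq : IsSlimInDegreeTwo q) (hX : IsBraidedRack X) {x y : X}
    (h : x ◃ y ≠ y) :
    v q x * v q y - (q.toFun x y : k) • (v q (x ◃ y) * v q x) +
      ((q.toFun x y : k) * (q.toFun (x ◃ y) x : k)) • (v q y * v q (x ◃ y)) = 0 := by
  have h1 := hq.2 x y h
  rw [braid_relation hX h, map_add, map_sub, map_smul, map_smul, toNichols_wd_two,
    toNichols_wd_two, toNichols_wd_two] at h1
  exact h1

/-- The kernel in degree two is that of 1 + c_q, and (1 + c_q)(1 − c_q + c_q²) = 1 + c_q³. On v_x ⊗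
v_y the map c_q³ is the scalar on the left-hand side, so slimness forces this scalar to be −1. -/
theorem IsSlimInDegreeTwo.cocycle_cube (hq : IsSlimInDegreeTwo q) (hX : IsBraidedRack X) {x y : X}
    (h : x ◃ y ≠ y) :
    (q.toFun x y : k) * (q.toFun (x ◃ y) x : k) * (q.toFun y (x ◃ y) : k) = -1 := by
  have h1 := (toNichols_eq_zero q).1 (hq.2 x y h)
  have h2 : y ◃ (x ◃ y) = x := hX.act_act_self fun h' => h (hX.comm_symm h')
  rw [braid_relation hX h, map_add, map_sub, map_smul, map_smul, totalSymmetrizer_wd_two,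
    totalSymmetrizer_wd_two, totalSymmetrizer_wd_two, hX.act_self_act h, h2] at h1
  have h3 : (1 + (q.toFun x y : k) * (q.toFun (x ◃ y) x : k) * (q.toFun y (x ◃ y) : k)) •
      wd k [x, y] = 0 := by
    rw [← h1]; module
  have h4 := congrArg (wordCoeff [x, y]) h3
  rw [map_smul, wordCoeff_self, map_zero, smul_eq_mul, mul_one] at h4
  linear_combination h4

variable (q)

/-! ### Homogeneous elements -/

/-- The classes of the linear combinations of words of length `n` and degree `g`. -/
noncomputable def homogeneousPart (n : ℕ) (g : Rack.EnvelGroup X) :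
    Submodule k (NicholsAlgebra q) :=
  (Submodule.span k (wd k '' {l : List X | l.length = n ∧ wordDegree l = g})).map
    (toNichols q).toLinearMap

theorem wordDegree_append (l l' : List X) :
    wordDegree (l ++ l') = wordDegree l * wordDegree l' := by
  simp [wordDegree]

theorem toNichols_wd_mem_homogeneousPart (l : List X) :
    toNichols q (wd k l) ∈ homogeneousPart q l.length (wordDegree l) :=
  ⟨_, Submodule.subset_span ⟨l, ⟨rfl, rfl⟩, rfl⟩, rfl⟩

theorem mul_mem_homogeneousPart {m n : ℕ} {g h : Rack.EnvelGroup X} {x y : NicholsAlgebra q}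
    (hx : x ∈ homogeneousPart q m g) (hy : y ∈ homogeneousPart q n h) :
    x * y ∈ homogeneousPart q (m + n) (g * h) := by
  obtain ⟨s, hs, rfl⟩ := hx
  obtain ⟨t, ht, rfl⟩ := hy
  refine ⟨s * t, ?_, map_mul (toNichols q) s t⟩
  have := Submodule.mul_mem_mul hs ht
  rw [Submodule.span_mul_span] at this
  refine Submodule.span_mono ?_ this
  rintro _ ⟨_, ⟨l, ⟨rfl, rfl⟩, rfl⟩, _, ⟨l', ⟨rfl, rfl⟩, rfl⟩, rfl⟩
  exact ⟨l ++ l', ⟨List.length_append, wordDegree_append _ _⟩, wd_append _ _⟩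

theorem homogeneousPart_le_degreePart (n : ℕ) (g : Rack.EnvelGroup X) :
    homogeneousPart q n g ≤ degreePart q n :=
  Submodule.map_mono (Submodule.span_mono (Set.image_mono fun _ hl => hl.1))

theorem coaction_of_mem {n : ℕ} {g : Rack.EnvelGroup X} {x : NicholsAlgebra q}
    (hx : x ∈ homogeneousPart q n g) : coaction q x = MonoidAlgebra.single g (1 : k) ⊗ₜ x := by
  obtain ⟨t, ht, rfl⟩ := hx
  induction ht using Submodule.span_induction with
  | mem y h =>
    obtain ⟨l, ⟨-, rfl⟩, rfl⟩ := h
    change TensorProduct.map LinearMap.id (toNichols q).toLinearMap (coactionT (wd k l)) = _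
    rw [coactionT_wd, TensorProduct.map_tmul]
    rfl
  | zero => simp
  | add y z _ _ hy hz => rw [map_add, map_add, hy, hz, TensorProduct.tmul_add]
  | smul a y _ hy => rw [map_smul, map_smul, hy, TensorProduct.tmul_smul]

variable {q} in
theorem exists_mem_homogeneousPart_of_mem_closure {T : Set (NicholsAlgebra q)}
    (hT : ∀ x ∈ T, ∃ n g, x ∈ homogeneousPart q n g) {x : NicholsAlgebra q}
    (hx : x ∈ Submonoid.closure T) : ∃ n g, x ∈ homogeneousPart q n g := by
  induction hx using Submonoid.closure_induction with
  | mem x hx => exact hT x hx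
  | one => exact ⟨_, _, toNichols_wd_mem_homogeneousPart q []⟩
  | mul x y _ _ hx hy =>
    obtain ⟨m, g, hx⟩ := hx
    obtain ⟨n, h, hy⟩ := hy
    exact ⟨_, _, mul_mem_homogeneousPart q hx hy⟩

variable {q} in
-- The subalgebra is spanned by the monomials in its generators, and each monomial is homogeneous.
-- The subcomodule property follows in the same way.
theorem isGradedSubspace_adjoin {T : Set (NicholsAlgebra q)}
    (hT : ∀ x ∈ T, ∃ n g, x ∈ homogeneousPart q n g) :
    IsGradedSubspace q (Subalgebra.toSubmodule (Algebra.adjoin k T)) := by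
  refine le_antisymm ?_ (iSup_le fun n => inf_le_left)
  conv_lhs => rw [Algebra.adjoin_eq_span]
  refine Submodule.span_le.2 fun x hx => ?_
  obtain ⟨n, g, hn⟩ := exists_mem_homogeneousPart_of_mem_closure hT hx
  refine Submodule.mem_iSup_of_mem n ⟨?_, homogeneousPart_le_degreePart q n g hn⟩
  rw [Algebra.adjoin_eq_span]
  exact Submodule.subset_span hx

variable {q} in
theorem isSubcomodule_adjoin {T : Set (NicholsAlgebra q)}
    (hT : ∀ x ∈ T, ∃ n g, x ∈ homogeneousPart q n g) :
    IsSubcomodule q (Subalgebra.toSubmodule (Algebra.adjoin k T)) := by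
  have : Subalgebra.toSubmodule (Algebra.adjoin k T) ≤ (LinearMap.range (TensorProduct.map
      (LinearMap.id : MonoidAlgebra k (Rack.EnvelGroup X) →ₗ[k] _)
      (Subalgebra.toSubmodule (Algebra.adjoin k T)).subtype)).comap (coaction q) := by
    conv_lhs => rw [Algebra.adjoin_eq_span]
    refine Submodule.span_le.2 fun x hx => ?_
    obtain ⟨n, g, hn⟩ := exists_mem_homogeneousPart_of_mem_closure hT hx
    have hx' : x ∈ Subalgebra.toSubmodule (Algebra.adjoin k T) := by
      rw [Algebra.adjoin_eq_span]
      exact Submodule.subset_span hx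
    change coaction q x ∈ LinearMap.range _
    rw [coaction_of_mem q hn]
    exact ⟨MonoidAlgebra.single g 1 ⊗ₜ ⟨x, hx'⟩, rfl⟩
  exact this

/-! ### Left coideals -/

/-- The subspace `𝓑(V) ⊗ C` of `𝓑(V) ⊗ 𝓑(V)`. -/
noncomputable def tensorRight (C : Submodule k (NicholsAlgebra q)) :
    Submodule k (NicholsAlgebra q ⊗[k] NicholsAlgebra q) :=
  LinearMap.range (TensorProduct.map
    (LinearMap.id : NicholsAlgebra q →ₗ[k] NicholsAlgebra q) C.subtype)

variable {q}

theorem tmul_mem_tensorRight {C : Submodule k (NicholsAlgebra q)} (s : NicholsAlgebra q)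
    {u : NicholsAlgebra q} (hu : u ∈ C) : s ⊗ₜ[k] u ∈ tensorRight q C :=
  ⟨s ⊗ₜ ⟨u, hu⟩, rfl⟩

theorem map_mem_tensorRight {C : Submodule k (NicholsAlgebra q)}
    (F : Module.End k (NicholsAlgebra q ⊗[k] NicholsAlgebra q))
    (hF : ∀ s, ∀ u ∈ C, F (s ⊗ₜ u) ∈ tensorRight q C)
    {z : NicholsAlgebra q ⊗[k] NicholsAlgebra q} (hz : z ∈ tensorRight q C) :
    F z ∈ tensorRight q C := by
  obtain ⟨w, rfl⟩ := hz
  induction w with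
  | zero => simp
  | add z w hz hw => rw [map_add, map_add]; exact add_mem hz hw
  | tmul s u => exact hF s u u.2

/-- Monomials are built by adding one generator at a time on the left, starting from 1 with Δ(1) = 1
⊗ 1. Hence the coideal condition has to be propagated only through left multiplication by a
generator. -/
theorem isLeftCoideal_adjoin {T : Set (NicholsAlgebra q)}
    (hT : ∀ x ∈ T, ∀ y ∈ Algebra.adjoin k T,
      comul q y ∈ tensorRight q (Subalgebra.toSubmodule (Algebra.adjoin k T)) →
      comul q (x * y) ∈ tensorRight q (Subalgebra.toSubmodule (Algebra.adjoin k T))) :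
    IsLeftCoideal q (Subalgebra.toSubmodule (Algebra.adjoin k T)) := by
  have h1 : comul q 1 = 1 ⊗ₜ 1 := by
    rw [← map_one (toNichols q), comul_toNichols, ← wd_nil, comulT_nil, TensorProduct.map_tmul]
    simp [wd_nil]
  have : Subalgebra.toSubmodule (Algebra.adjoin k T) ≤
      (tensorRight q (Subalgebra.toSubmodule (Algebra.adjoin k T))).comap (comul q) := by
    conv_lhs => rw [Algebra.adjoin_eq_span]
    refine Submodule.span_le.2 fun x hx => ?_
    induction hx using Submonoid.closure_induction_left with
    | one =>
      change comul q 1 ∈ tensorRight q _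
      rw [h1]
      exact tmul_mem_tensorRight _ (one_mem (Algebra.adjoin k T))
    | mul_left x hx y hy ih =>
      refine hT x hx y ?_ ih
      rw [← Subalgebra.mem_toSubmodule, Algebra.adjoin_eq_span]
      exact Submodule.subset_span hy
  exact this

theorem comul_v_mul_mem {C : Subalgebra k (NicholsAlgebra q)} {x : X} (hx : v q x ∈ C)
    {y : NicholsAlgebra q} (hy : comul q y ∈ tensorRight q (Subalgebra.toSubmodule C)) :
    comul q (v q x * y) ∈ tensorRight q (Subalgebra.toSubmodule C) := by
  rw [comul_v_mul]
  refine map_mem_tensorRight _ (fun s u hu => ?_) hy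
  rw [nicholsStep_tmul]
  exact add_mem (tmul_mem_tensorRight _ hu) (tmul_mem_tensorRight _ (C.mul_mem hx hu))

end RackNichols

namespace RackNichols

open scoped Quandles TensorProduct

variable {k : Type*} [Field k] {X : Type*} [Rack X] {q : TwoCocycle k X}

/-! ### The cubic element -/

variable (q) in
-- The map c₁c₂ sends the word xyz to a multiple of (x ◃ (y ◃ z)) x y, so its iterates turn cba into
-- dcb and then into edc, in the notation of the theorem.
theorem cubic_toNichols (a b c : X) :
    toNichols q ((1 - braid q 0 * braid q 1 + (braid q 0 * braid q 1) ^ 2 :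
        Module.End k (TAlg k X)) (vT k c * vT k b * vT k a)) =
      toNichols q (wd k [c, b, a] -
        ((q.toFun b a : k) * (q.toFun c (b ◃ a) : k)) • wd k [c ◃ (b ◃ a), c, b] +
        ((q.toFun b a : k) * (q.toFun c (b ◃ a) : k) *
          ((q.toFun c b : k) * (q.toFun (c ◃ (b ◃ a)) (c ◃ b) : k))) •
            wd k [(c ◃ (b ◃ a)) ◃ (c ◃ b), c ◃ (b ◃ a), c]) := by
  have h : ∀ x y z : X, (braid q 0 * braid q 1) (wd k [x, y, z]) =
      ((q.toFun y z : k) * (q.toFun x (y ◃ z) : k)) • wd k [x ◃ (y ◃ z), x, y] := by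
    intro x y z
    rw [Module.End.mul_apply, braid_succ_wd, braid_zero_wd, mul_smul_comm, ← wd_cons, map_smul,
      braid_zero_wd, smul_smul]
  rw [vT, vT, vT, ← wd_append, ← wd_append, List.singleton_append, List.cons_append,
    List.singleton_append, LinearMap.add_apply, LinearMap.sub_apply, pow_two,
    Module.End.mul_apply (braid q 0 * braid q 1), Module.End.one_apply, h, map_smul, h, smul_smul]

/-- The operator of multiplication by `Δ(Z)` preserves `𝓑(V) ⊗ C`. -/
theorem cubic_step_mem {C : Submodule k (NicholsAlgebra q)} {a b c d e p r : X}
    (hba : b ◃ a = p) (hcp : c ◃ p = d) (hcb : c ◃ b = r) (hca : c ◃ a = e) (hdr : d ◃ r = e)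
    (hed : e ◃ d = r) (hap : a ◃ p = b)
    (hrel : v q r * v q e - (q.toFun r e : k) • (v q d * v q r) +
      ((q.toFun r e : k) * (q.toFun d r : k)) • (v q e * v q d) = 0)
    (hcube : (q.toFun r e : k) * (q.toFun d r : k) * (q.toFun e d : k) = -1)
    {α β : k} (hα : α = (q.toFun b a : k) * (q.toFun c p : k))
    (hβ : β = (q.toFun c b : k) * (q.toFun d r : k))
    (ha : ∀ u ∈ C, v q a * u ∈ C) (hb : ∀ u ∈ C, v q b * u ∈ C) (hd : ∀ u ∈ C, v q d * u ∈ C)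
    (he : ∀ u ∈ C, v q e * u ∈ C)
    (hN : ∀ u ∈ C, (v q c * v q a - (q.toFun c a : k) • (v q e * v q c)) * u ∈ C)
    (hZ : ∀ u ∈ C, (v q c * v q b * v q a - α • (v q d * v q c * v q b) +
      (α * β) • (v q e * v q d * v q c)) * u ∈ C)
    (s : NicholsAlgebra q) {u : NicholsAlgebra q} (hu : u ∈ C) :
    nicholsStep q c (nicholsStep q b (nicholsStep q a (s ⊗ₜ u))) -
      α • nicholsStep q d (nicholsStep q c (nicholsStep q b (s ⊗ₜ u))) +
      (α * β) • nicholsStep q e (nicholsStep q d (nicholsStep q c (s ⊗ₜ u))) ∈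
        tensorRight q C := by
  -- In the present names: q_{r,e} q_{c,a} = q_{c,p} q_{b,a}, the right-hand side being α.
  have hcoc := q.cocycle' c b a
  rw [hcb, hca, hba] at hcoc
  -- The relations g_{x ◃ y} g_x = g_x g_y move g_c to the outside. With them g_d g_c g_b and g_e
  -- g_d g_c both become g_c g_b g_a, and g_e g_c becomes g_c g_a.
  have a1 : ∀ w, nicholsAct q d (nicholsAct q c w) = nicholsAct q c (nicholsAct q p w) :=
    fun w => by rw [← hcp, nicholsAct_nicholsAct]
  have a2 : ∀ w, nicholsAct q p (nicholsAct q b w) = nicholsAct q b (nicholsAct q a w) :=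
    fun w => by rw [← hba, nicholsAct_nicholsAct]
  have a5 : ∀ w, nicholsAct q e (nicholsAct q c w) = nicholsAct q c (nicholsAct q a w) :=
    fun w => by rw [← hca, nicholsAct_nicholsAct]
  have a6 : ∀ w, nicholsAct q a (nicholsAct q p w) = nicholsAct q b (nicholsAct q a w) :=
    fun w => by rw [← nicholsAct_nicholsAct, hap]
  -- The expansion collected by right tensor factors. The right factors v_c u, v_c v_b u and v_d v_c
  -- u have dropped out; v_c v_a u and v_e v_c u are merged into one term, and so are the three
  -- cubic ones.
  have key : nicholsStep q c (nicholsStep q b (nicholsStep q a (s ⊗ₜ u))) -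
      α • nicholsStep q d (nicholsStep q c (nicholsStep q b (s ⊗ₜ u))) +
      (α * β) • nicholsStep q e (nicholsStep q d (nicholsStep q c (s ⊗ₜ u))) =
      ((v q c * v q b * v q a - α • (v q d * v q c * v q b) +
        (α * β) • (v q e * v q d * v q c)) * s) ⊗ₜ u +
      (v q c * (v q b * nicholsAct q a s)) ⊗ₜ (v q a * u) +
      (v q c * nicholsAct q b (v q a * s) - α • (v q d * (v q c * nicholsAct q b s))) ⊗ₜ
        (v q b * u) +
      (-(α • nicholsAct q d (v q c * (v q b * s))) +
        (α * β) • (v q e * nicholsAct q d (v q c * s))) ⊗ₜ (v q d * u) +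
      ((α * β) • nicholsAct q e (v q d * (v q c * s))) ⊗ₜ (v q e * u) +
      (v q c * nicholsAct q b (nicholsAct q a s)) ⊗ₜ (v q b * (v q a * u)) +
      (-(α • nicholsAct q d (v q c * nicholsAct q b s))) ⊗ₜ (v q d * (v q b * u)) +
      ((α * β) • nicholsAct q e (nicholsAct q d (v q c * s))) ⊗ₜ (v q e * (v q d * u)) +
      ((q.toFun c b : k) • (v q r * nicholsAct q c (nicholsAct q a s))) ⊗ₜ
        ((v q c * v q a - (q.toFun c a : k) • (v q e * v q c)) * u) +
      nicholsAct q c (nicholsAct q b (nicholsAct q a s)) ⊗ₜ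
        ((v q c * v q b * v q a - α • (v q d * v q c * v q b) +
          (α * β) • (v q e * v q d * v q c)) * u) := by
    -- The part of the expansion with right factor v_c u is q_{c,b} q_{c,a} times this vanishing
    -- tensor.
    have hrel' := congrArg (fun w => (w * nicholsAct q c s) ⊗ₜ[k] (v q c * u)) hrel
    simp only [add_mul, sub_mul, smul_mul_assoc, mul_assoc, TensorProduct.add_tmul,
      TensorProduct.sub_tmul, ← TensorProduct.smul_tmul', zero_mul, TensorProduct.zero_tmul]
      at hrel'
    simp only [nicholsStep_tmul, map_add, nicholsAct_mul, map_smul, hba, hcp, hcb, hca, hdr, hed,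
      a1, a2, a5, a6, add_mul, sub_mul, smul_mul_assoc, mul_smul_comm, mul_assoc,
      TensorProduct.add_tmul, TensorProduct.sub_tmul, TensorProduct.neg_tmul,
      TensorProduct.tmul_add, TensorProduct.tmul_sub, ← TensorProduct.smul_tmul',
      TensorProduct.tmul_smul]
    subst hα hβ
    linear_combination (norm := skip) ((q.toFun c b : k) * (q.toFun c a : k)) • hrel'
    match_scalars
    any_goals ring1
    -- Three coefficients are not identities of polynomials in the values of q. They belong to v_d
    -- v_r and v_e v_d at the right factor v_c u, where the cocycle identity suffices, and to v_r at
    -- v_e v_c u, where the product −1 is needed too.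
    · linear_combination (q.toFun c b : k) * hcoc
    · linear_combination (-(q.toFun c b : k) * (q.toFun d r : k)) * hcoc
    · linear_combination (-(q.toFun c b : k) * (q.toFun d r : k) * (q.toFun e d : k)) * hcoc +
        ((q.toFun c a : k) * (q.toFun c b : k)) * hcube
  rw [key]
  refine add_mem (add_mem (add_mem (add_mem (add_mem (add_mem (add_mem (add_mem (add_mem ?_ ?_) ?_)
    ?_) ?_) ?_) ?_) ?_) ?_) ?_
  · exact tmul_mem_tensorRight _ hu
  · exact tmul_mem_tensorRight _ (ha u hu)
  · exact tmul_mem_tensorRight _ (hb u hu)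
  · exact tmul_mem_tensorRight _ (hd u hu)
  · exact tmul_mem_tensorRight _ (he u hu)
  · exact tmul_mem_tensorRight _ (hb _ (ha u hu))
  · exact tmul_mem_tensorRight _ (hd _ (hb u hu))
  · exact tmul_mem_tensorRight _ (he _ (hd u hu))
  · exact tmul_mem_tensorRight _ (hN u hu)
  · exact tmul_mem_tensorRight _ (hZ u hu)

/-- Here β stands for the whole coefficient of the third monomial, which for Z is the product αβ. -/
theorem comul_cubic_mul {a b c d e : X} (α β : k) (y : NicholsAlgebra q) :
    comul q ((v q c * v q b * v q a - α • (v q d * v q c * v q b) +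
      β • (v q e * v q d * v q c)) * y) =
    (nicholsStep q c * nicholsStep q b * nicholsStep q a -
      α • (nicholsStep q d * nicholsStep q c * nicholsStep q b) +
      β • (nicholsStep q e * nicholsStep q d * nicholsStep q c) :
        Module.End k (NicholsAlgebra q ⊗[k] NicholsAlgebra q)) (comul q y) := by
  simp only [add_mul, sub_mul, smul_mul_assoc, mul_assoc, map_add, map_sub, map_smul, comul_v_mul,
    LinearMap.add_apply, LinearMap.sub_apply, LinearMap.smul_apply, Module.End.mul_apply]

/-- The subalgebra generated by `v_a, v_b, v_d, v_e` and the cubic element is a left coideal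
subalgebra. -/
theorem isGradedLeftCoidealSubalgebra_adjoin (hX : IsBraidedRack X) (hq : IsSlimInDegreeTwo q)
    {a b c d e : X} (hac : a ≠ c) (h : a ◃ b ≠ b) (hd : d = c ◃ (b ◃ a)) (he : e = d ◃ (c ◃ b))
    {α β : k} (hα : α = (q.toFun b a : k) * (q.toFun c (b ◃ a) : k))
    (hβ : β = (q.toFun c b : k) * (q.toFun d (c ◃ b) : k)) :
    IsGradedLeftCoidealSubalgebra q (Algebra.adjoin k ({v q a, v q b, v q d, v q e} ∪
      {v q c * v q b * v q a - α • (v q d * v q c * v q b) +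
        (α * β) • (v q e * v q d * v q c)})) := by
  have hba : b ◃ a ≠ a := fun h' => h (hX.comm_symm h')
  -- The cyclic identities among e, c ◃ b and d are the images under c ◃ · of those among a, b and b
  -- ◃ a.
  have hre : (c ◃ b) ◃ (c ◃ a) = d := by rw [hd, ← Shelf.self_distrib]
  have hca : c ◃ a = e := by
    rw [he, hd, ← Shelf.self_distrib, hX.act_self_act hba]
  -- Non-commutation also transports along c ◃ ·, so the quadratic relation and its scalar identity
  -- are available for the pair (c ◃ b, e).
  have hre' : (c ◃ b) ◃ e ≠ e := by
    rw [← hca, ← Shelf.self_distrib]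
    exact fun h' => hba (act_left_cancel h')
  have hed : e ◃ d = c ◃ b := by
    rw [← hre, ← hca, ← Shelf.self_distrib, ← Shelf.self_distrib, hX.act_act_self h]
  rw [hca] at hre
  have hrel := hq.relation hX hre'
  have hcube := hq.cocycle_cube hX hre'
  rw [hre] at hrel hcube
  set Z := v q c * v q b * v q a - α • (v q d * v q c * v q b) +
    (α * β) • (v q e * v q d * v q c) with hZ
  set T : Set (NicholsAlgebra q) := {v q a, v q b, v q d, v q e} ∪ {Z} with hT
  have hTa : v q a ∈ Algebra.adjoin k T := Algebra.subset_adjoin (by simp [hT])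
  have hTb : v q b ∈ Algebra.adjoin k T := Algebra.subset_adjoin (by simp [hT])
  have hTd : v q d ∈ Algebra.adjoin k T := Algebra.subset_adjoin (by simp [hT])
  have hTe : v q e ∈ Algebra.adjoin k T := Algebra.subset_adjoin (by simp [hT])
  have hTZ : Z ∈ Algebra.adjoin k T := Algebra.subset_adjoin (by simp [hT])
  -- If c and a commute, then e = a and the element is zero. Otherwise the quadratic relation for
  -- (c, a) turns it into a multiple of v_a v_e, because a and e = c ◃ a are the remaining letters
  -- of that relation.
  have hN : v q c * v q a - (q.toFun c a : k) • (v q e * v q c) ∈ Algebra.adjoin k T := by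
    by_cases hc : c ◃ a = a
    · rw [hq.mul_comm_smul hc hac, ← hca, hc, sub_self]
      exact zero_mem _
    · have h1 := hq.relation hX hc
      rw [hca] at h1
      rw [eq_neg_of_add_eq_zero_left h1]
      exact neg_mem (Subalgebra.smul_mem _ (mul_mem hTa hTe) _)
  have hhom : ∀ x ∈ T, ∃ n g, x ∈ homogeneousPart q n g := by
    have hv : ∀ x : X, ∃ n g, v q x ∈ homogeneousPart q n g := fun x =>
      ⟨_, _, toNichols_wd_mem_homogeneousPart q [x]⟩
    have hg : ∀ x y : X, (Rack.toEnvelGroup X (x ◃ y) : Rack.EnvelGroup X) *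
        (Rack.toEnvelGroup X x : Rack.EnvelGroup X) = _ := toEnvelGroup_act
    -- The braiding preserves the degree in the enveloping group, so the three words of Z have a
    -- common degree.
    have h1 : wordDegree [d, c, b] = wordDegree [c, b, a] := by
      simp only [wordDegree_cons]
      rw [hd, ← mul_assoc, hg, mul_assoc, ← mul_assoc (Rack.toEnvelGroup X (b ◃ a) : Rack.EnvelGroup X),
        hg, mul_assoc]
    have h2 : wordDegree [e, d, c] = wordDegree [c, b, a] := by
      rw [← h1]
      simp only [wordDegree_cons]
      rw [he, ← mul_assoc, hg, mul_assoc, ← mul_assoc (Rack.toEnvelGroup X (c ◃ b) : Rack.EnvelGroup X),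
        hg, mul_assoc]
    rintro x ((rfl | rfl | rfl | rfl) | rfl)
    · exact hv _
    · exact hv _
    · exact hv _
    · exact hv _
    · refine ⟨3, wordDegree [c, b, a], add_mem (sub_mem ?_ (Submodule.smul_mem _ _ ?_))
        (Submodule.smul_mem _ _ ?_)⟩
      · rw [← toNichols_wd_three]
        exact toNichols_wd_mem_homogeneousPart q [c, b, a]
      · rw [← toNichols_wd_three, ← h1]
        exact toNichols_wd_mem_homogeneousPart q [d, c, b]
      · rw [← toNichols_wd_three, ← h2]
        exact toNichols_wd_mem_homogeneousPart q [e, d, c]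
  refine ⟨isGradedSubspace_adjoin hhom, isSubcomodule_adjoin hhom, isLeftCoideal_adjoin ?_⟩
  rintro x ((rfl | rfl | rfl | rfl) | rfl) y - hy
  · exact comul_v_mul_mem hTa hy
  · exact comul_v_mul_mem hTb hy
  · exact comul_v_mul_mem hTd hy
  · exact comul_v_mul_mem hTe hy
  · rw [hZ, comul_cubic_mul]
    refine map_mem_tensorRight _ (fun s u hu => ?_) hy
    exact cubic_step_mem rfl hd.symm rfl hca he.symm hed (hX.act_act_self h) hrel hcube hα hβ
      (fun _ => Subalgebra.mul_mem _ hTa) (fun _ => Subalgebra.mul_mem _ hTb)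
      (fun _ => Subalgebra.mul_mem _ hTd) (fun _ => Subalgebra.mul_mem _ hTe)
      (fun _ => Subalgebra.mul_mem _ hN) (fun _ => Subalgebra.mul_mem _ hTZ) s hu

end RackNichols

namespace RackNichols

open scoped Quandles TensorProduct

variable {k : Type*} [Field k] {X : Type*}

/-! ### Projections onto homogeneous components. -/

theorem projT_of_mem {n : ℕ} {t : TAlg k X} (ht : t ∈ tensorPower k X n) : projT n t = t := by
  have : tensorPower k X n ≤ LinearMap.ker (projT n - 1 : Module.End k (TAlg k X)) := by
    refine Submodule.span_le.2 ?_
    rintro _ ⟨l, rfl, rfl⟩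
    simp [projT_wd]
  exact sub_eq_zero.1 (this ht)

theorem projT_of_mem_of_ne {m n : ℕ} (h : m ≠ n) {t : TAlg k X} (ht : t ∈ tensorPower k X m) :
    projT n t = 0 := by
  have : tensorPower k X m ≤ LinearMap.ker (projT n : Module.End k (TAlg k X)) := by
    refine Submodule.span_le.2 ?_
    rintro _ ⟨l, rfl, rfl⟩
    simp [projT_wd, h]
  exact this ht

variable [Rack X] (q : TwoCocycle k X)

/-! ### The cubic element is not generated in degree one -/

theorem nicholsEmb_toNichols (t : TAlg k X) :
    nicholsEmb q (toNichols q t) = totalSymmetrizer q t := rfl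

/-- If `w` does not occur in the symmetrization of any word of length three with letters in `A`,
then the corresponding functional vanishes on the subalgebra generated by `A`. -/
theorem wordCoeff_nicholsEmb_eq_zero {A : Set X} {w : List X} (hw : w.length = 3)
    (hA : ∀ x ∈ A, ∀ y ∈ A, ∀ z ∈ A, wordCoeff w (totalSymmetrizer q (wd k [x, y, z])) = 0)
    {s : NicholsAlgebra q} (hs : s ∈ Algebra.adjoin k (v q '' A)) :
    wordCoeff w (nicholsEmb q s) = 0 := by
  have hword : ∀ s ∈ Submonoid.closure (v q '' A), ∃ l : List X, (∀ x ∈ l, x ∈ A) ∧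
      toNichols q (wd k l) = s := by
    intro s hs
    induction hs using Submonoid.closure_induction_left with
    | one => exact ⟨[], by simp, rfl⟩
    | mul_left x hx y _ ih =>
      obtain ⟨l, hl, rfl⟩ := ih
      obtain ⟨x, hx, rfl⟩ := hx
      exact ⟨x :: l, List.forall_mem_cons.2 ⟨hx, hl⟩, by rw [wd_cons, map_mul]; rfl⟩
  have : Subalgebra.toSubmodule (Algebra.adjoin k (v q '' A)) ≤
      LinearMap.ker (wordCoeff w ∘ₗ nicholsEmb q) := by
    rw [Algebra.adjoin_eq_span]
    refine Submodule.span_le.2 fun s hs => ?_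
    obtain ⟨l, hl, rfl⟩ := hword s hs
    change wordCoeff w (totalSymmetrizer q (wd k l)) = 0
    -- The symmetrizers preserve length, so only words of length three can contribute to the
    -- coefficient of w.
    by_cases h : l.length = 3
    · obtain ⟨x, y, z, rfl⟩ := List.length_eq_three.1 h
      exact hA x (hl x (by simp)) y (hl y (by simp)) z (hl z (by simp))
    · exact wordCoeff_of_mem (by rw [hw]; exact Ne.symm h) (totalSymmetrizer_mem q (wd_mem l))
  exact this hs

/-! ### The component of degree one of a generated subalgebra. -/

theorem mul_mem_degreePart {m n : ℕ} {x y : NicholsAlgebra q} (hx : x ∈ degreePart q m)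
    (hy : y ∈ degreePart q n) : x * y ∈ degreePart q (m + n) := by
  obtain ⟨s, hs, rfl⟩ := hx
  obtain ⟨t, ht, rfl⟩ := hy
  refine ⟨s * t, ?_, map_mul (toNichols q) s t⟩
  have := Submodule.mul_mem_mul hs ht
  rw [tensorPower, tensorPower, Submodule.span_mul_span] at this
  refine Submodule.span_mono ?_ this
  rintro _ ⟨_, ⟨l, rfl, rfl⟩, _, ⟨l', rfl, rfl⟩, rfl⟩
  exact ⟨l ++ l', List.length_append, wd_append _ _⟩

theorem v_mem_degreePart (x : X) : v q x ∈ degreePart q 1 := ⟨vT k x, wd_mem [x], rfl⟩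

theorem nicholsEmb_mem {n : ℕ} {x : NicholsAlgebra q} (hx : x ∈ degreePart q n) :
    nicholsEmb q x ∈ tensorPower k X n := by
  obtain ⟨t, ht, rfl⟩ := hx
  exact totalSymmetrizer_mem q ht

/-- Generators of degree at least two do not contribute to the component of degree one. -/
theorem adjoin_union_inf_degreePart_one_le {S T : Set (NicholsAlgebra q)}
    (hS : ∀ x ∈ S, x ∈ degreePart q 1) (hT : ∀ x ∈ T, ∃ n, 2 ≤ n ∧ x ∈ degreePart q n) :
    Subalgebra.toSubmodule (Algebra.adjoin k (S ∪ T)) ⊓ degreePart q 1 ≤ Submodule.span k S := by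
  -- A monomial is 1, a single generator from S, or of degree at least two.
  have hmon : ∀ x ∈ Submonoid.closure (S ∪ T), x = 1 ∨ x ∈ S ∨ ∃ n, 2 ≤ n ∧ x ∈ degreePart q n := by
    intro x hx
    induction hx using Submonoid.closure_induction_left with
    | one => exact Or.inl rfl
    | mul_left x hx y _ ih =>
      have hx' : ∃ n, 1 ≤ n ∧ x ∈ degreePart q n := by
        rcases hx with hx | hx
        · exact ⟨1, le_rfl, hS x hx⟩
        · obtain ⟨n, hn, hx⟩ := hT x hx
          exact ⟨n, by omega, hx⟩
      obtain ⟨m, hm, hxm⟩ := hx'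
      rcases ih with rfl | hy | ⟨n, hn, hy⟩
      · rw [mul_one]
        exact Or.inr (hx.imp id (hT x))
      · exact Or.inr (Or.inr ⟨m + 1, by omega, mul_mem_degreePart q hxm (hS y hy)⟩)
      · exact Or.inr (Or.inr ⟨m + n, by omega, mul_mem_degreePart q hxm hy⟩)
  -- The degree-one projection is taken after the embedding into T(V), so its kernel absorbs all
  -- monomials of degree different from one.
  have hle : Subalgebra.toSubmodule (Algebra.adjoin k (S ∪ T)) ≤
      Submodule.span k S ⊔ LinearMap.ker (projT 1 ∘ₗ nicholsEmb q) := by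
    rw [Algebra.adjoin_eq_span]
    have hker : ∀ n x, n ≠ 1 → x ∈ degreePart q n →
        x ∈ LinearMap.ker (projT 1 ∘ₗ nicholsEmb q) := fun n x hn hx =>
      projT_of_mem_of_ne hn (nicholsEmb_mem q hx)
    refine Submodule.span_le.2 fun x hx => ?_
    rcases hmon x hx with rfl | hx | ⟨n, hn, hx⟩
    · exact Submodule.mem_sup_right (hker 0 1 (by omega) ⟨1, wd_mem [], map_one (toNichols q)⟩)
    · exact Submodule.mem_sup_left (Submodule.subset_span hx)
    · exact Submodule.mem_sup_right (hker n x (by omega) hx)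
  rintro x ⟨hx, hx1⟩
  obtain ⟨s, hs, r, hr, rfl⟩ := Submodule.mem_sup.1 (hle hx)
  have hs1 : s ∈ degreePart q 1 := Submodule.span_le.2 hS hs
  have hr1 : r ∈ degreePart q 1 := (Submodule.add_mem_iff_right _ hs1).1 hx1
  -- The summand r has degree one, so `projT 1` fixes its image under the embedding; this image is
  -- therefore zero.
  have hr0 : nicholsEmb q r = 0 := by
    rw [← projT_of_mem (nicholsEmb_mem q hr1)]
    exact hr
  rw [(injective_iff_map_eq_zero _).1 (nicholsEmb_injective q) r hr0, add_zero]
  exact hs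

theorem wordCoeff_totalSymmetrizer_eq_zero {x y z : X} {w : List X} (h1 : [x, y, z] ≠ w)
    (h2 : [x, y ◃ z, y] ≠ w) (h3 : [x ◃ y, x, z] ≠ w) (h4 : [x ◃ y, x ◃ z, x] ≠ w)
    (h5 : [x ◃ (y ◃ z), x, y] ≠ w) (h6 : [x ◃ (y ◃ z), x ◃ y, x] ≠ w) :
    wordCoeff w (totalSymmetrizer q (wd k [x, y, z])) = 0 := by
  simp only [totalSymmetrizer_wd_three, map_add, map_smul, wordCoeff_of_ne h1, wordCoeff_of_ne h2,
    wordCoeff_of_ne h3, wordCoeff_of_ne h4, wordCoeff_of_ne h5, wordCoeff_of_ne h6, smul_zero,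
    add_zero]

/-- Four of the other five words begin with x ◃ y or x ◃ (y ◃ z), so comparing first letters
excludes them; only [x, y ◃ z, y] needs a separate condition. -/
theorem wordCoeff_totalSymmetrizer_self {x y z : X}
    (h2 : [x, y ◃ z, y] ≠ [x, y, z]) (h3 : x ◃ y ≠ x) (h4 : x ◃ (y ◃ z) ≠ x) :
    wordCoeff [x, y, z] (totalSymmetrizer q (wd k [x, y, z])) = 1 := by
  have e : ∀ {x' y' z' : X}, x' ≠ x → [x', y', z'] ≠ [x, y, z] := fun h h' =>
    h (List.cons.inj h').1
  simp only [totalSymmetrizer_wd_three, map_add, map_smul, wordCoeff_self, wordCoeff_of_ne h2,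
    wordCoeff_of_ne (e h3), wordCoeff_of_ne (e h4), smul_zero, add_zero]

variable {q} in
/-- The cubic element does not lie in the subalgebra generated by `v_a, v_b, v_d, v_e`. -/
theorem cubic_notMem_adjoin (hX : IsBraidedRack X) {a b c d e : X} (hab : a ≠ b) (hac : a ≠ c)
    (hbc : b ≠ c) (h : a ◃ b ≠ b) (hd : d = c ◃ (b ◃ a)) (he : e = d ◃ (c ◃ b))
    (hca : c ◃ a ≠ a) (hcb : c ◃ b ≠ b) (hcp : c ◃ (b ◃ a) ≠ b ◃ a)
    (hne : a ◃ b ≠ c ∨ a ◃ c ≠ b ◃ a) (α β : k) :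
    toNichols q (wd k [c, b, a] - α • wd k [d, c, b] + β • wd k [e, d, c]) ∉
      Algebra.adjoin k ({v q a, v q b, v q d, v q e} : Set (NicholsAlgebra q)) := by
  have hba : b ◃ a ≠ a := fun h' => h (hX.comm_symm h')
  have hbc' : b ◃ c ≠ c := fun h' => hcb (hX.comm_symm h')
  have hac' : a ◃ c ≠ c := fun h' => hca (hX.comm_symm h')
  have hcae : c ◃ a = e := by
    rw [he, hd, ← Shelf.self_distrib, hX.act_self_act hba]
  have hre : (c ◃ b) ◃ e = d := by rw [hd, ← hcae, ← Shelf.self_distrib]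
  have hed : e ◃ d = c ◃ b := by
    rw [← hre, ← hcae, ← Shelf.self_distrib, ← Shelf.self_distrib, hX.act_act_self h]
  have hap : a ◃ (b ◃ a) = b := hX.act_act_self h
  have hbr : b ◃ (c ◃ b) = c := hX.act_act_self hbc'
  have hdc : d ◃ c = b ◃ a := by rw [hd, hX.act_self_act hcp]
  have hec : c ≠ e := fun h' => hX.act_ne_left hac.symm (hcae.trans h'.symm)
  have hpb : b ◃ a ≠ b := hX.act_ne_left hab.symm
  have hcp' : c ≠ b ◃ a := fun h' => hcp (by rw [← h', hX.1])
  have hcd : c ≠ d := fun h' => hX.act_ne_left hcp' (hd ▸ h'.symm)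
  have hrc : c ◃ b ≠ c := hX.act_ne_left hbc.symm
  have hra : c ◃ b ≠ a := fun h' => hcp' (by rw [← h', hbr])
  have hrd : c ◃ b ≠ d := fun h' => hpb (act_left_cancel (hd ▸ h'.symm))
  have hrE : c ◃ b ≠ e := fun h' => hab (act_left_cancel (hcae.trans h'.symm))
  have hdp : b ◃ a ≠ d := fun h' => hcp (hd ▸ h'.symm)
  -- The map a ◃ · sends b ◃ a to b, and it sends e = c ◃ a to c.
  have hpe : b ◃ a ≠ e := fun h' => hbc (by
    rw [← hap, h', ← hcae, hX.act_act_self hac'])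
  -- Equality would make a and d non-commuting, and then a = d ◃ (a ◃ d) = d ◃ (c ◃ b) = e = c ◃ a,
  -- contrary to `hca`.
  have hadr : a ◃ d ≠ c ◃ b := fun h' => by
    have h1 : a ◃ d ≠ d := fun h'' => hrd (h'.symm.trans h'')
    have h2 := hX.act_act_self (x := d) (y := a) fun h'' => h1 (hX.comm_symm h'')
    rw [h', ← he] at h2
    exact hca (hcae.trans h2)
  -- This excludes the word x ◃ (y ◃ z), x, y with x = b and y = a. As b ◃ (c ◃ b) = c, the equation
  -- says a ◃ z = c ◃ b, and each of the four letters fails this.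
  have hbad : ∀ z : X, z = a ∨ z = b ∨ z = d ∨ z = e → b ◃ (a ◃ z) ≠ c := by
    intro z hz h'
    have h1 : a ◃ z = c ◃ b := act_left_cancel (h'.trans hbr.symm)
    rcases hz with rfl | rfl | rfl | rfl
    · rw [hX.1] at h1
      exact hra h1.symm
    · rw [h1, hbr] at h'
      rw [← h1] at hbr
      exact hac ((hX.act_act_self hba).symm.trans hbr)
    · exact hadr h1
    · rw [← hcae, hX.act_act_self hac'] at h1
      exact hrc h1.symm
  -- In this case both a ◃ b = c and a ◃ c = b ◃ a would follow, which is exactly what `hne`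
  -- forbids.
  have hdbad : ¬(e = b ∧ d = a) := by
    rintro ⟨heb, hda⟩
    have h1 : (b ◃ a) ◃ (c ◃ (b ◃ a)) = c := hX.act_act_self fun h' => hcp (hX.comm_symm h')
    rw [← hd, hda] at h1
    have h2 : a ◃ ((b ◃ a) ◃ a) = b ◃ a := hX.act_act_self fun h' => hpb (h'.symm.trans hap)
    rw [h1] at h2
    have h3 : a ◃ (c ◃ a) = c := hX.act_act_self hac'
    rw [hcae, heb] at h3
    exact hne.elim (fun h' => h' h3) fun h' => h' h2
  have hset : ({v q a, v q b, v q d, v q e} : Set (NicholsAlgebra q)) =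
      v q '' {a, b, d, e} := by
    simp [Set.image_insert_eq]
  rw [hset]
  intro hmem
  -- The test functional is the coefficient of the leading word cba. On the cubic element it is 1,
  -- from the identity permutation acting on cba, and all other contributions vanish.
  have h0 := wordCoeff_nicholsEmb_eq_zero q (w := [c, b, a]) rfl (fun x hx y hy z hz => ?_) hmem
  · rw [nicholsEmb_toNichols, map_add, map_sub, map_smul, map_smul, map_add, map_sub, map_smul,
      map_smul, wordCoeff_totalSymmetrizer_self q _ hrc (hd ▸ hcd.symm),
      wordCoeff_totalSymmetrizer_eq_zero, wordCoeff_totalSymmetrizer_eq_zero] at h0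
    · simp at h0
    · exact fun h' => hec (List.cons.inj h').1.symm
    · exact fun h' => hec (List.cons.inj h').1.symm
    · rw [hed]
      exact fun h' => hrc (List.cons.inj h').1
    · rw [hed]
      exact fun h' => hrc (List.cons.inj h').1
    -- The word e ◃ (d ◃ c), e, d from the symmetrization of edc: the only comparison that needs the
    -- disjunctive hypothesis.
    · intro h'
      simp only [List.cons.injEq] at h'
      exact hdbad ⟨h'.2.1, h'.2.2.1⟩
    · intro h'
      simp only [List.cons.injEq] at h'
      exact hca (hcae.trans h'.2.2.1)
    · exact fun h' => hcd (List.cons.inj h').1.symm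
    · exact fun h' => hcd (List.cons.inj h').1.symm
    · rw [hdc]
      exact fun h' => hcp' (List.cons.inj h').1.symm
    · rw [hdc]
      exact fun h' => hcp' (List.cons.inj h').1.symm
    · rw [← he]
      exact fun h' => hec (List.cons.inj h').1.symm
    · rw [← he]
      exact fun h' => hec (List.cons.inj h').1.symm
    · intro h'
      simp only [List.cons.injEq] at h'
      exact hpb h'.2.1
  -- None of the four letters is c, c ◃ b or b ◃ a. These are the letters that a word would need in
  -- order to reach cba, since b ◃ (c ◃ b) = c and a ◃ (b ◃ a) = b; the pattern left over is handled
  -- by `hbad`.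
  · have hxc : ∀ x ∈ ({a, b, d, e} : Set X), x ≠ c := by
      rintro x (rfl | rfl | rfl | rfl)
      exacts [hac, hbc, hcd.symm, hec.symm]
    have hxr : ∀ x ∈ ({a, b, d, e} : Set X), x ≠ c ◃ b := by
      rintro x (rfl | rfl | rfl | rfl)
      exacts [hra.symm, hcb.symm, hrd.symm, hrE.symm]
    have hxp : ∀ x ∈ ({a, b, d, e} : Set X), x ≠ b ◃ a := by
      rintro x (rfl | rfl | rfl | rfl)
      exacts [hba.symm, hpb.symm, hdp.symm, hpe.symm]
    refine wordCoeff_totalSymmetrizer_eq_zero q (fun h' => ?_) (fun h' => ?_) (fun h' => ?_)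
      (fun h' => ?_) (fun h' => ?_) (fun h' => ?_) <;> simp only [List.cons.injEq, and_true] at h'
    · exact hxc x hx h'.1
    · exact hxc x hx h'.1
    · obtain ⟨h1, rfl, -⟩ := h'
      exact hxr y hy (act_left_cancel (h1.trans hbr.symm))
    · obtain ⟨-, h2, rfl⟩ := h'
      exact hxp z hz (act_left_cancel (h2.trans hap.symm))
    · obtain ⟨h1, rfl, rfl⟩ := h'
      exact hbad z hz h1
    · obtain ⟨-, h2, rfl⟩ := h'
      exact hxp y hy (act_left_cancel (h2.trans hap.symm))

end RackNichols

/-! ### The theorem. -/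

theorem mainTheorem6 {k : Type*} [Field k] [IsAlgClosed k] [CharZero k] {X : Type*} [Rack X]
    (q : TwoCocycle k X) (hX : IsBraidedRack X) (hslim : IsSlimInDegreeTwo q)
    (a b c : X) (hab : a ≠ b) (hac : a ≠ c) (hbc : b ≠ c) (h : a ◃ b ≠ b)
    (d e : X) (hd : d = c ◃ (b ◃ a)) (he : e = d ◃ (c ◃ b))
    (S : Set (NicholsAlgebra q)) (hS : S = {v q a, v q b, v q d, v q e})
    (c₁ c₂ : Module.End k (TAlg k X)) (hc₁ : c₁ = braid q 0) (hc₂ : c₂ = braid q 1)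
    (Z : NicholsAlgebra q)
    (hZ : Z = toNichols q
      ((1 - c₁ * c₂ + (c₁ * c₂) ^ 2 : Module.End k (TAlg k X)) (vT k c * vT k b * vT k a)))
    (C : Subalgebra k (NicholsAlgebra q)) (hC : C = Algebra.adjoin k (S ∪ {Z})) :
    IsGradedLeftCoidealSubalgebra q C ∧
      (c ◃ a ≠ a → c ◃ b ≠ b → c ◃ (b ◃ a) ≠ b ◃ a → (a ◃ b ≠ c ∨ a ◃ c ≠ b ◃ a) →
        Z ∉ Algebra.adjoin k S ∧ ¬ IsGeneratedInDegreeOne q C) := by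
  subst hc₁ hc₂
  rw [cubic_toNichols, ← hd, ← he] at hZ
  subst hC hS
  refine ⟨?_, fun hca hcb hcp hne => ?_⟩
  · rw [map_add, map_sub, map_smul, map_smul, toNichols_wd_three, toNichols_wd_three,
      toNichols_wd_three] at hZ
    subst hZ
    exact isGradedLeftCoidealSubalgebra_adjoin hX hslim hac h hd he rfl rfl
  · have hZS : Z ∉ Algebra.adjoin k ({v q a, v q b, v q d, v q e} : Set (NicholsAlgebra q)) := by
      rw [hZ]
      exact cubic_notMem_adjoin hX hab hac hbc h hd he hca hcb hcp hne _ _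
    refine ⟨hZS, fun hgen => hZS ?_⟩
    have hZ3 : Z ∈ degreePart q 3 := by
      rw [hZ]
      exact ⟨_, add_mem (sub_mem (wd_mem [c, b, a]) (Submodule.smul_mem _ _ (wd_mem [d, c, b])))
        (Submodule.smul_mem _ _ (wd_mem [e, d, c])), rfl⟩
    have hle := adjoin_union_inf_degreePart_one_le q
      (S := {v q a, v q b, v q d, v q e}) (T := {Z})
      (by rintro x (rfl | rfl | rfl | rfl) <;> exact v_mem_degreePart q _)
      (by rintro x rfl; exact ⟨3, by omega, hZ3⟩)
    have hZC : Z ∈ Algebra.adjoin k ({v q a, v q b, v q d, v q e} ∪ {Z}) :=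
      Algebra.subset_adjoin (Or.inr rfl)
    rw [hgen] at hZC
    -- If C were generated by C(1), which is contained in the span of S, then Z would lie in ⟨S⟩.
    refine Algebra.adjoin_le (fun x hx => ?_) hZC
    exact Algebra.span_le_adjoin k _ (hle hx)
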